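/- Theorem (Average-case lower bound for shallow brickwork random quantum circuits). There is a universal constant $c>0$ such that the following holds for all integers $n\ge 1$, $d\ge 0$, $q\ge 0$ and all reals $\tau,\epsilon,\alpha,\beta$ with $\alpha,\beta\in[0,1]$. Let $N=2^n$, $0<\tau\le\epsilon\le\frac13\left(1-\frac1N\right)$ and $$\frac{\log_2 n}{\log_2(5/4)}\;\le\; d\;\le\;\frac{n+\log_2 n}{\log_2(5/4)} .$$ Let $\mathsf{RQC}(n,d)$ be the law of the unitary $U=L_d\cdots L_2L_1$ on $n$ qubits, where the layer $L_l$ is the tensor product of two-qubit gates on the neighbouring pairs $(1,2),(3,4),\dots$ if $l$ is odd and $(2,3),(4,5),\dots$ if $l$ is even (with the identity on unpaired qubits), and all gates are independent and Haar distributed on $U(4)$. For a quantum process $\mathcal E$ (a completely positive trace-preserving map on $N\times N$ matrices), a query of tolerance $\tau$ to the oracle $\mathsf{QPStat}_{\mathcal E}$ consists of a density matrix $\rho$ and a Hermitian $O$ with $\|O\|_\infty\le 1$, and is answered by some real number $v$ with $|v-\mathrm{Tr}(O\,\mathcal E(\rho))|\le\tau$. Write $\mathsf{QPStat}_U$ for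 the oracle of the process $\rho\mapsto U\rho U^\dagger$, and let $d_\diamond(\mathcal E,\mathcal F)=\frac12\|\mathcal E-\mathcal F\|_\diamond=\max_\rho\frac12\|(\mathcal E\otimes \mathrm{id})(\rho)-(\mathcal F\otimes \mathrm{id})(\rho)\|_1$, the maximum being over all states $\rho$ of the system together with an ancilla of dimension $N$. Suppose that a randomized adaptive algorithm makes $q$ queries of tolerance $\tau$ to $\mathsf{QPStat}_U$ and that, with probability at least $\beta$ over $U\sim\mathsf{RQC}(n,d)$, the following holds: whatever the valid answers of the oracle are, with probability at least $\alpha$ over its internal randomness the algorithm outputs a quantum process $\hat{\mathcal E}$ with $d_\diamond(\hat{\mathcal E},U(\cdot)U^\dagger)\le\epsilon$. Then $$q+1\;\ge\; c\,\frac{(2\alpha-1)\,\beta}{n}\,\tau^2\left(\frac54\right)^d .$$ -/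

import Mathlib

open MeasureTheory Matrix
open scoped ENNReal ComplexOrder

noncomputable section

namespace PSQ

/-! ### Measurable structure on matrices and Haar measure on the unitary group -/

section Haar

/-- The product (equivalently, Borel) sigma-algebra on complex matrices. -/
instance instMeasurableSpaceMatrix {m n : Type*} : MeasurableSpace (Matrix m n ℂ) :=
  inferInstanceAs (MeasurableSpace (m → n → ℂ))

instance instBorelSpaceMatrix {m n : Type*} [Fintype m] [Fintype n] :
    BorelSpace (Matrix m n ℂ) :=
  inferInstanceAs (BorelSpace (m → n → ℂ))

instance instSecondCountableMatrix {m n : Type*} [Fintype m] [Fintype n] :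
    SecondCountableTopology (Matrix m n ℂ) :=
  inferInstanceAs (SecondCountableTopology (m → n → ℂ))

instance instCompactSpaceUnitary {ι : Type*} [Fintype ι] [DecidableEq ι] :
    CompactSpace (Matrix.unitaryGroup ι ℂ) := by
  refine isCompact_iff_compactSpace.1 (?_ : IsCompact (Matrix.unitaryGroup ι ℂ : Set (Matrix ι ι ℂ)))
  have hK : IsCompact
      (Set.univ.pi fun _ : ι => Set.univ.pi fun _ : ι => Metric.closedBall (0 : ℂ) 1) :=
    isCompact_univ_pi fun _ => isCompact_univ_pi fun _ => isCompact_closedBall 0 1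
  refine IsCompact.of_isClosed_subset (hK : IsCompact (X := Matrix ι ι ℂ) _)
    (isClosed_unitary (R := Matrix ι ι ℂ)) ?_
  intro U hU i _ j _
  simpa using entry_norm_bound_of_unitary hU i j

instance instSecondCountableUnitary {ι : Type*} [Fintype ι] [DecidableEq ι] :
    SecondCountableTopology (Matrix.unitaryGroup ι ℂ) :=
  TopologicalSpace.Subtype.secondCountableTopology _

/-- The Haar probability measure on the unitary group `U(ι)`. -/
def haarUnitary (ι : Type*) [Fintype ι] [DecidableEq ι] : Measure (Matrix.unitaryGroup ι ℂ) :=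
  Measure.haarMeasure ⊤

instance instIsProbabilityMeasureHaar (ι : Type*) [Fintype ι] [DecidableEq ι] :
    IsProbabilityMeasure (haarUnitary ι) :=
  ⟨by simpa [haarUnitary] using (Measure.haarMeasure_self
    (K₀ := (⊤ : TopologicalSpace.PositiveCompacts (Matrix.unitaryGroup ι ℂ))))⟩

end Haar

/-! ### Brickwork random quantum circuits -/

section Brickwork

/-- Labels of the computational basis of `n` qubits; `N = 2 ^ n` of them. -/
abbrev Qubits (n : ℕ) : Type := Fin n → Fin 2

/-- The two-qubit operator `g` acting on qubits `i` and `j` (in this order), tensored with the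
identity on all other qubits. -/
def localMatrix {n : ℕ} (i j : Fin n) (g : Matrix (Fin 2 × Fin 2) (Fin 2 × Fin 2) ℂ) :
    Matrix (Qubits n) (Qubits n) ℂ :=
  Matrix.of fun x y =>
    if ∀ k, k ≠ i → k ≠ j → x k = y k then g (x i, x j) (y i, y j) else 0

theorem localMatrix_one {n : ℕ} (i j : Fin n) : localMatrix i j 1 = 1 := by
  ext x y
  by_cases hxy : x = y
  · subst hxy; simp [localMatrix]
  · rw [Matrix.one_apply_ne hxy]
    simp only [localMatrix, Matrix.of_apply]
    split_ifs with h
    · refine Matrix.one_apply_ne fun h2 => hxy ?_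
      rw [Prod.mk.injEq] at h2
      funext k
      by_cases hi : k = i
      · rw [hi]; exact h2.1
      by_cases hj : k = j
      · rw [hj]; exact h2.2
      exact h k hi hj
    · rfl

theorem localMatrix_conjTranspose {n : ℕ} (i j : Fin n)
    (g : Matrix (Fin 2 × Fin 2) (Fin 2 × Fin 2) ℂ) :
    (localMatrix i j g)ᴴ = localMatrix i j gᴴ := by
  ext x y
  simp only [localMatrix, Matrix.conjTranspose_apply, Matrix.of_apply]
  have : (∀ k, k ≠ i → k ≠ j → y k = x k) ↔ (∀ k, k ≠ i → k ≠ j → x k = y k) :=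
    ⟨fun h k a b => (h k a b).symm, fun h k a b => (h k a b).symm⟩
  simp only [this]
  split_ifs <;> simp

theorem localMatrix_mul {n : ℕ} {i j : Fin n} (hij : i ≠ j)
    (g h : Matrix (Fin 2 × Fin 2) (Fin 2 × Fin 2) ℂ) :
    localMatrix i j g * localMatrix i j h = localMatrix i j (g * h) := by
  ext x z
  simp only [Matrix.mul_apply, localMatrix, Matrix.of_apply]
  by_cases hxz : ∀ k, k ≠ i → k ≠ j → x k = z k
  · rw [if_pos hxz]
    symm
    refine Finset.sum_of_injOn
      (fun p : Fin 2 × Fin 2 => Function.update (Function.update x i p.1) j p.2) ?_ ?_ ?_ ?_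
    · rintro ⟨a, b⟩ - ⟨a', b'⟩ - hp
      have h1 := congrFun hp i
      have h2 := congrFun hp j
      simp [Function.update_of_ne hij] at h1 h2
      simp [h1, h2]
    · intro p _; simp
    · intro y _ hy
      by_cases hxy : ∀ k, k ≠ i → k ≠ j → x k = y k
      · exfalso
        refine hy ⟨(y i, y j), by simp, ?_⟩
        funext k
        by_cases hj : k = j
        · subst hj; simp
        by_cases hi : k = i
        · subst hi; simp [Function.update_of_ne hj]
        · simp [Function.update_of_ne hj, Function.update_of_ne hi, hxy k hi hj]
      · simp [hxy]
    · rintro ⟨a, b⟩ _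
      have hx : ∀ k, k ≠ i → k ≠ j →
          x k = Function.update (Function.update x i a) j b k := fun k hi hj => by
        simp [Function.update_of_ne hj, Function.update_of_ne hi]
      have hz : ∀ k, k ≠ i → k ≠ j →
          Function.update (Function.update x i a) j b k = z k := fun k hi hj => by
        rw [← hx k hi hj]; exact hxz k hi hj
      rw [if_pos hx, if_pos hz]
      simp [Function.update_of_ne hij]
  · rw [if_neg hxz]
    refine Finset.sum_eq_zero fun y _ => ?_
    by_cases hxy : ∀ k, k ≠ i → k ≠ j → x k = y k
    · have : ¬ ∀ k, k ≠ i → k ≠ j → y k = z k := fun hyz =>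
        hxz fun k a b => (hxy k a b).trans (hyz k a b)
      simp [this]
    · simp [hxy]

/-- The `n`-qubit unitary that applies the two-qubit gate `g` to the distinct qubits `i`, `j`. -/
def localGate {n : ℕ} (i j : Fin n) (hij : i ≠ j) (g : Matrix.unitaryGroup (Fin 2 × Fin 2) ℂ) :
    Matrix.unitaryGroup (Qubits n) ℂ :=
  ⟨localMatrix i j g, by
    rw [Matrix.mem_unitaryGroup_iff, Matrix.star_eq_conjTranspose, localMatrix_conjTranspose,
      localMatrix_mul hij, ← Matrix.star_eq_conjTranspose,
      Matrix.mem_unitaryGroup_iff.1 g.2, localMatrix_one]⟩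

theorem continuous_localGate {n : ℕ} (i j : Fin n) (hij : i ≠ j) :
    Continuous (localGate i j hij) := by
  refine Continuous.subtype_mk ?_ _
  refine continuous_matrix fun x y => ?_
  simp only [localMatrix, Matrix.of_apply]
  split_ifs
  · exact (Continuous.matrix_elem continuous_subtype_val _ _)
  · exact continuous_const

/-- In layer `l` (layers and qubits are numbered from `0`) there is a gate on qubits `i`, `i + 1`
exactly if both exist and `i` has the same parity as `l`: the layers number `0, 2, 4, …` have gates
on `(0,1), (2,3), …`, and the layers number `1, 3, 5, …` on `(1,2), (3,4), …`. -/
def HasGate (n l i : ℕ) : Prop := i + 1 < n ∧ i % 2 = l % 2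

instance instDecidableHasGate (n l i : ℕ) : Decidable (HasGate n l i) :=
  inferInstanceAs (Decidable (_ ∧ _))

/-- The places of the gates in a brickwork circuit on `n` qubits of depth `d`. -/
abbrev GatePlace (n d : ℕ) : Type := {p : Fin d × Fin n // HasGate n p.1 p.2}

/-- A choice of a two-qubit unitary for every place. -/
abbrev GateChoice (n d : ℕ) : Type := GatePlace n d → Matrix.unitaryGroup (Fin 2 × Fin 2) ℂ

/-- Layer `l` of a brickwork circuit: the product of its (commuting) gates. -/
def brickLayer {n d : ℕ} (g : GateChoice n d) (l : Fin d) : Matrix.unitaryGroup (Qubits n) ℂ :=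
  ((List.finRange n).map fun i : Fin n =>
    if h : HasGate n l i then
      localGate i ⟨i + 1, h.1⟩ (fun e => by simpa using congrArg Fin.val e) (g ⟨(l, i), h⟩)
    else 1).prod

/-- The unitary of a brickwork circuit: `layer (d - 1) * ⋯ * layer 1 * layer 0`. -/
def brickCircuit {n d : ℕ} (g : GateChoice n d) : Matrix.unitaryGroup (Qubits n) ℂ :=
  ((List.finRange d).reverse.map (brickLayer g)).prod

theorem continuous_brickCircuit (n d : ℕ) :
    Continuous (brickCircuit : GateChoice n d → Matrix.unitaryGroup (Qubits n) ℂ) := by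
  refine continuous_list_prod _ fun l _ => continuous_list_prod _ fun i _ => ?_
  split_ifs with h
  · exact (continuous_localGate _ _ _).comp (continuous_apply _)
  · exact continuous_const

theorem measurable_brickCircuit (n d : ℕ) :
    Measurable (brickCircuit : GateChoice n d → Matrix.unitaryGroup (Qubits n) ℂ) :=
  (continuous_brickCircuit n d).measurable

/-- `RQC n d`: the law of the unitary of a brickwork circuit on `n` qubits of depth `d` whose gates
are independent and Haar distributed on `U(4)`. -/
def RQC (n d : ℕ) : Measure (Matrix.unitaryGroup (Qubits n) ℂ) :=
  (Measure.pi fun _ : GatePlace n d => haarUnitary (Fin 2 × Fin 2)).map brickCircuit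

instance instIsProbabilityMeasureRQC (n d : ℕ) : IsProbabilityMeasure (RQC n d) :=
  Measure.isProbabilityMeasure_map (measurable_brickCircuit n d).aemeasurable

end Brickwork

/-! ### States, observables, quantum processes, diamond distance -/

section Processes

variable {ι κ : Type*} [Fintype ι] [DecidableEq ι] [Fintype κ] [DecidableEq κ]

/-- Density matrices. -/
abbrev State (ι : Type*) [Fintype ι] : Type _ :=
  {ρ : Matrix ι ι ℂ // ρ.PosSemidef ∧ ρ.trace = 1}

/-- Hermitian matrices of operator norm at most `1`. -/
abbrev Observable (ι : Type*) [Fintype ι] [DecidableEq ι] : Type _ :=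
  {O : Matrix ι ι ℂ // O.IsHermitian ∧ ‖Matrix.toEuclideanCLM (n := ι) (𝕜 := ℂ) O‖ ≤ 1}

/-- `Φ ⊗ id` on `ι × κ` matrices: `Φ` is applied to each of the blocks indexed by `κ × κ`. -/
def ampliation (κ : Type*) (Φ : Matrix ι ι ℂ →ₗ[ℂ] Matrix ι ι ℂ)
    (X : Matrix (ι × κ) (ι × κ) ℂ) : Matrix (ι × κ) (ι × κ) ℂ :=
  Matrix.of fun a b => Φ (Matrix.of fun i j => X (i, a.2) (j, b.2)) a.1 b.1

/-- Quantum processes: completely positive trace-preserving linear maps. -/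
structure Channel (ι : Type*) [Fintype ι] where
  /-- The underlying linear map on matrices. -/
  toLin : Matrix ι ι ℂ →ₗ[ℂ] Matrix ι ι ℂ
  trace_map : ∀ X, (toLin X).trace = X.trace
  completelyPositive : ∀ (k : ℕ) (X : Matrix (ι × Fin k) (ι × Fin k) ℂ),
    X.PosSemidef → (ampliation (Fin k) toLin X).PosSemidef

/-- The linear map `X ↦ U X Uᴴ`. -/
def conjLin (U : Matrix ι ι ℂ) : Matrix ι ι ℂ →ₗ[ℂ] Matrix ι ι ℂ where
  toFun X := U * X * Uᴴ
  map_add' X Y := by rw [Matrix.mul_add, Matrix.add_mul]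
  map_smul' c X := by simp

theorem ampliation_conjLin (U : Matrix ι ι ℂ) (X : Matrix (ι × κ) (ι × κ) ℂ) :
    ampliation κ (conjLin U) X =
      Matrix.kronecker U (1 : Matrix κ κ ℂ) * X * (Matrix.kronecker U (1 : Matrix κ κ ℂ))ᴴ := by
  ext ⟨i, k⟩ ⟨j, l⟩
  simp [ampliation, conjLin, Matrix.mul_apply, Fintype.sum_prod_type, Matrix.kronecker,
    Matrix.kroneckerMap_apply, Matrix.one_apply, Matrix.conjTranspose_apply,
    apply_ite (starRingEnd ℂ)]

/-- The unitary process `ρ ↦ U ρ U†`. -/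
def unitaryChannel (U : Matrix.unitaryGroup ι ℂ) : Channel ι where
  toLin := conjLin U
  trace_map X := by
    change ((U : Matrix ι ι ℂ) * X * (U : Matrix ι ι ℂ)ᴴ).trace = _
    rw [Matrix.trace_mul_comm, ← Matrix.mul_assoc, ← Matrix.star_eq_conjTranspose,
      Matrix.mem_unitaryGroup_iff'.1 U.2, Matrix.one_mul]
  completelyPositive k X hX := by
    rw [ampliation_conjLin]
    exact hX.mul_mul_conjTranspose_same _

/-- The trace norm: the sum of the singular values of `A`. -/
def traceNorm (A : Matrix ι ι ℂ) : ℝ :=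
  ∑ i, √((Matrix.isHermitian_conjTranspose_mul_self A).eigenvalues i)

/-- The diamond distance `½ ‖E - F‖_⋄`: the largest trace distance between `(E ⊗ id) ρ` and
`(F ⊗ id) ρ`, over all states `ρ` of the system together with an ancilla of the same dimension. -/
def diamondDist (E F : Channel ι) : ℝ≥0∞ :=
  ⨆ ρ : State (ι × ι),
    ENNReal.ofReal (traceNorm (ampliation ι E.toLin ρ.1 - ampliation ι F.toLin ρ.1) / 2)

end Processes

/-! ### Quantum process statistical queries and learners -/

section Learning

variable {ι : Type*} [Fintype ι] [DecidableEq ι]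

/-- The expectation value `Tr(O E(ρ))` (a real number). -/
def expectation (E : Channel ι) (ρ : State ι) (O : Observable ι) : ℝ :=
  (O.1 * E.toLin ρ.1).trace.re

/-- `f` is a way for the oracle `QPStat_E` to answer queries of tolerance `τ`: to the query
`(ρ, O)` it answers with some real number within `τ` of `Tr(O E(ρ))`. -/
structure IsQPStat (E : Channel ι) (τ : ℝ) (f : State ι × Observable ι → ℝ) : Prop where
  measurable : Measurable f
  accurate : ∀ ρ O, |f (ρ, O) - expectation E ρ O| ≤ τ

/-- A randomized adaptive learner that makes `q` queries; `Ω` carries its internal randomness.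
Query number `k` depends on the randomness and on the `k` previous answers, the hypothesis on the
randomness and on all answers. -/
structure Learner (ι : Type*) [Fintype ι] [DecidableEq ι] (Ω : Type*) [MeasurableSpace Ω]
    (q : ℕ) where
  /-- Query number `k` (counted from `0`). -/
  query : (k : Fin q) → Ω → (Fin k → ℝ) → State ι × Observable ι
  measurable_query : ∀ k : Fin q, Measurable fun p : Ω × (Fin k → ℝ) => query k p.1 p.2
  /-- The hypothesis produced after all queries. -/
  hypothesis : Ω → (Fin q → ℝ) → Channel ι
  measurable_hypothesis : ∀ X : Matrix ι ι ℂ,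
    Measurable fun p : Ω × (Fin q → ℝ) => (hypothesis p.1 p.2).toLin X

/-- The first `k` answers that the learner receives when the oracle answers according to `f`. -/
def Learner.answers {Ω : Type*} [MeasurableSpace Ω] {q : ℕ} (A : Learner ι Ω q)
    (f : State ι × Observable ι → ℝ) (ω : Ω) : (k : ℕ) → k ≤ q → Fin k → ℝ
  | 0, _ => Fin.elim0
  | k + 1, h =>
    let a := A.answers f ω k (Nat.le_of_succ_le h)
    Fin.snoc (α := fun _ => ℝ) a (f (A.query ⟨k, h⟩ ω a))

/-- The hypothesis produced when the oracle answers according to `f`. -/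
def Learner.output {Ω : Type*} [MeasurableSpace Ω] {q : ℕ} (A : Learner ι Ω q)
    (f : State ι × Observable ι → ℝ) (ω : Ω) : Channel ι :=
  A.hypothesis ω (A.answers f ω q le_rfl)

/-- Whatever the (valid) answers of `QPStat_E` of tolerance `τ` are, the learner `A` produces with
probability at least `α` over its internal randomness `P` a hypothesis within diamond distance `ε`
of the unknown process `E`. -/
def Learner.Learns {Ω : Type*} [MeasurableSpace Ω] {q : ℕ} (A : Learner ι Ω q) (P : Measure Ω)
    (τ ε α : ℝ) (E : Channel ι) : Prop :=
  ∀ f, IsQPStat E τ f →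
    ENNReal.ofReal α ≤ P {ω | diamondDist (A.output f ω) E ≤ ENNReal.ofReal ε}

end Learning

end PSQ

end

/-!
Any learner can be fed the answer `Tr(O) / 2 ^ n` to every query `(ρ, O)`; this carries no
information about the circuit, so the final hypothesis depends on the internal randomness only.
The answer is valid unless `Tr(O U ρ U†)` deviates from `Tr(O) / 2 ^ n` by more than `τ`, and by
Chebyshev's inequality this is unlikely for a random brickwork circuit, as the variance of
`Tr(O U ρ U†)` is of order `2 ^ (-n) + (4 / 5) ^ d` (`integral_sub_sq_le`). The success of a fixed
hypothesis `E` is one more such event: with `ρ₀` a basis state, closeness of `E` to the unitary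
process forces `Tr(E(ρ₀) U ρ₀ U†) ≥ 1 - ε` (`one_sub_le_fidelity`), while `E(ρ₀)` is an observable
with `Tr(E(ρ₀)) / 2 ^ n = 1 / 2 ^ n`. A union bound over these `q + 1` events, averaged over the
internal randomness, gives `α β τ ^ 2 ≤ (q + 1) · variance` (`mul_mul_sq_le_of_learns`), and in the
given range of depths `2 ^ (-n) ≤ n (4 / 5) ^ d`.

For the variance, expand `O` in Pauli strings. A Haar random two-qubit gate makes the coefficients
of distinct Pauli matrices uncorrelated and moves the squares of the nontrivial ones uniformly
among the fifteen nontrivial Pauli matrices (`adjMoment_eq`); this follows from left invariance of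
the Haar measure under Pauli matrices and under the gates `(τ_a + τ_b) / √2`, and from the
orthogonality of the adjoint action. Hence the second moments of the coefficients obey a linear
recursion along the circuit (`coeffMoment_self`), which becomes transparent for the subsystem
purities `purity f A`: a gate across the boundary of `A` replaces the purity of `A` by `2 / 5` times
the sum of the purities of the two sets obtained by moving the boundary past the gate
(`purity_gateStep_of_not_iff`). The functions `2 ^ (-|A|)` and `2 ^ |A|` are stationary. Subtracting
the combination of them with the right values at the empty and the full set leaves a function that
vanishes at these two sets, and every layer shrinks it by `4 / 5`, since of two consecutive layers
at least one cuts a given nontrivial set (`norm_purity_brick_le`). Inclusion–exclusion recovers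
the individual second moments without loss, because `∑ A ⊆ B, 2 ^ |A| = 3 ^ |B|` is the number of
strings with support `B` (`norm_le_of_norm_purity_le`).
-/

noncomputable section

namespace PSQ

/-! ### Pauli matrices on one and two qubits -/

/-- The Pauli matrices `1, X, Y, Z`, numbered from `0` to `3`. -/
def sigma : Fin 4 → Matrix (Fin 2) (Fin 2) ℂ :=
  ![!![1, 0; 0, 1], !![0, 1; 1, 0], !![0, -Complex.I; Complex.I, 0], !![1, 0; 0, -1]]

/-- The sign `ε` with `σ_a σ_b = ε σ_b σ_a`. -/
def commSign (a b : Fin 4) : ℤ := if a = 0 ∨ b = 0 ∨ a = b then 1 else -1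

theorem sigma_zero : sigma 0 = 1 := by
  ext i j; fin_cases i <;> fin_cases j <;> simp [sigma]

theorem sigma_conjTranspose (a : Fin 4) : (sigma a)ᴴ = sigma a := by
  fin_cases a <;> ext i j <;> fin_cases i <;> fin_cases j <;> simp [sigma]

theorem sigma_mul_self (a : Fin 4) : sigma a * sigma a = 1 := by
  fin_cases a <;> ext i j <;> fin_cases i <;> fin_cases j <;>
    simp [sigma, Matrix.mul_apply]

theorem sigma_comm (a b : Fin 4) :
    sigma a * sigma b = (commSign a b : ℂ) • (sigma b * sigma a) := by
  fin_cases a <;> fin_cases b <;> ext i j <;> fin_cases i <;> fin_cases j <;>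
    simp [sigma, commSign, Matrix.mul_apply]

theorem trace_sigma_mul (a b : Fin 4) :
    (sigma a * sigma b).trace = if a = b then 2 else 0 := by
  fin_cases a <;> fin_cases b <;>
    simp [sigma, Matrix.trace, one_add_one_eq_two]

/-- The Pauli matrices resolve the swap of two qubits. -/
theorem sum_sigma_mul_sigma (x y z w : Fin 2) :
    ∑ a, sigma a x y * sigma a z w = if x = w ∧ y = z then 2 else 0 := by
  fin_cases x <;> fin_cases y <;> fin_cases z <;> fin_cases w <;>
    simp [sigma, Fin.sum_univ_four, one_add_one_eq_two]

/-- The sixteen two-qubit Pauli matrices `σ_a ⊗ σ_b`. -/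
def tau (p : Fin 4 × Fin 4) : Matrix (Fin 2 × Fin 2) (Fin 2 × Fin 2) ℂ :=
  Matrix.kronecker (sigma p.1) (sigma p.2)

/-- The sign `ε` with `τ_p τ_q = ε τ_q τ_p`. -/
def commSign₂ (p q : Fin 4 × Fin 4) : ℤ := commSign p.1 q.1 * commSign p.2 q.2

theorem tau_apply (p : Fin 4 × Fin 4) (x y : Fin 2 × Fin 2) :
    tau p x y = sigma p.1 x.1 y.1 * sigma p.2 x.2 y.2 := rfl

theorem tau_mul (p q : Fin 4 × Fin 4) :
    tau p * tau q = Matrix.kronecker (sigma p.1 * sigma q.1) (sigma p.2 * sigma q.2) := by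
  rw [tau, tau]
  exact (Matrix.mul_kronecker_mul _ _ _ _).symm

theorem tau_zero : tau 0 = 1 := by
  simp only [tau, Prod.fst_zero, Prod.snd_zero, sigma_zero]
  exact Matrix.one_kronecker_one

theorem tau_conjTranspose (p : Fin 4 × Fin 4) : (tau p)ᴴ = tau p := by
  rw [tau]
  refine (Matrix.conjTranspose_kronecker _ _).trans ?_
  rw [sigma_conjTranspose, sigma_conjTranspose]; rfl

theorem tau_mul_self (p : Fin 4 × Fin 4) : tau p * tau p = 1 := by
  rw [tau_mul, sigma_mul_self, sigma_mul_self]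
  exact Matrix.one_kronecker_one

theorem tau_comm (p q : Fin 4 × Fin 4) :
    tau p * tau q = (commSign₂ p q : ℂ) • (tau q * tau p) := by
  rw [tau_mul, tau_mul, sigma_comm p.1, sigma_comm p.2]
  ext x y
  simp [Matrix.kronecker, commSign₂]
  ring

theorem trace_tau_mul (p q : Fin 4 × Fin 4) :
    (tau p * tau q).trace = if p = q then 4 else 0 := by
  rw [tau_mul]
  refine (Matrix.trace_kronecker _ _).trans ?_
  rw [trace_sigma_mul, trace_sigma_mul]
  obtain ⟨a, b⟩ := p
  obtain ⟨c, d⟩ := q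
  by_cases h1 : a = c <;> by_cases h2 : b = d <;> simp [h1, h2]
  norm_num

theorem sum_tau_mul_tau (x y z w : Fin 2 × Fin 2) :
    ∑ p, tau p x y * tau p z w = if x = w ∧ y = z then 4 else 0 := by
  have h : ∑ p, tau p x y * tau p z w =
      (∑ a, sigma a x.1 y.1 * sigma a z.1 w.1) * ∑ a, sigma a x.2 y.2 * sigma a z.2 w.2 := by
    rw [Finset.sum_mul_sum, Fintype.sum_prod_type]
    refine Finset.sum_congr rfl fun a _ => Finset.sum_congr rfl fun b _ => ?_
    simp only [tau_apply]; ring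
  rw [h, sum_sigma_mul_sigma, sum_sigma_mul_sigma]
  obtain ⟨x1, x2⟩ := x
  obtain ⟨y1, y2⟩ := y
  obtain ⟨z1, z2⟩ := z
  obtain ⟨w1, w2⟩ := w
  by_cases h1 : x1 = w1 <;> by_cases h2 : y1 = z1 <;> by_cases h3 : x2 = w2 <;>
    by_cases h4 : y2 = z2 <;> simp [h1, h2, h3, h4]
  norm_num

theorem sum_smul_tau (A : Matrix (Fin 2 × Fin 2) (Fin 2 × Fin 2) ℂ) :
    A = ∑ p, ((tau p * A).trace / 4) • tau p := by
  ext x y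
  simp only [Matrix.sum_apply, Matrix.smul_apply, smul_eq_mul]
  have h : ∀ p, (tau p * A).trace / 4 * tau p x y =
      ∑ z, ∑ w, (tau p x y * tau p z w) * (A w z / 4) := by
    intro p
    simp only [Matrix.trace, Matrix.diag, Matrix.mul_apply, Finset.sum_div, Finset.sum_mul]
    refine Finset.sum_congr rfl fun z _ => Finset.sum_congr rfl fun w _ => ?_
    ring
  simp only [h]
  rw [Finset.sum_comm]
  have : ∀ z, ∑ p, ∑ w, tau p x y * tau p z w * (A w z / 4) =
      ∑ w, (∑ p, tau p x y * tau p z w) * (A w z / 4) := by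
    intro z; rw [Finset.sum_comm]; simp only [Finset.sum_mul]
  simp only [this, sum_tau_mul_tau, ite_and]
  simp [mul_div_cancel₀]

theorem sum_trace_tau_mul_tau (A B : Matrix (Fin 2 × Fin 2) (Fin 2 × Fin 2) ℂ) :
    ∑ p, (tau p * A).trace * (tau p * B).trace = 4 * (A * B).trace := by
  conv_rhs => rw [sum_smul_tau A, Finset.sum_mul, Matrix.trace_sum, Finset.mul_sum]
  refine Finset.sum_congr rfl fun p _ => ?_
  rw [Matrix.smul_mul, Matrix.trace_smul, smul_eq_mul]
  ring

/-! ### The second moment of a Haar random two-qubit gate -/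

/-- The entry `R_ac` of the adjoint action of a two-qubit gate:
`g† τ_a g = ∑ c, R_ac(g) τ_c`. -/
def adjEntry (g : Matrix.unitaryGroup (Fin 2 × Fin 2) ℂ) (a c : Fin 4 × Fin 4) : ℂ :=
  (tau c * ((g : Matrix _ _ ℂ)ᴴ * tau a * (g : Matrix _ _ ℂ))).trace / 4

theorem conj_tau_eq_sum (g : Matrix.unitaryGroup (Fin 2 × Fin 2) ℂ) (a : Fin 4 × Fin 4) :
    (g : Matrix _ _ ℂ)ᴴ * tau a * (g : Matrix _ _ ℂ) = ∑ c, adjEntry g a c • tau c :=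
  sum_smul_tau _

theorem continuous_adjEntry (a c : Fin 4 × Fin 4) : Continuous fun g => adjEntry g a c := by
  unfold adjEntry
  fun_prop

theorem integrable_adjEntry_mul (a b c e : Fin 4 × Fin 4) :
    Integrable (fun g => adjEntry g a c * adjEntry g b e) (haarUnitary (Fin 2 × Fin 2)) := by
  have hc : Continuous fun g => adjEntry g a c * adjEntry g b e :=
    (continuous_adjEntry a c).mul (continuous_adjEntry b e)
  rw [← integrableOn_univ]
  exact hc.continuousOn.integrableOn_compact isCompact_univ

/-- Left invariance alone determines the second moments below; right invariance is not needed. -/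
instance instIsMulLeftInvariantHaar (ι : Type*) [Fintype ι] [DecidableEq ι] :
    (haarUnitary ι).IsMulLeftInvariant :=
  inferInstanceAs (Measure.haarMeasure ⊤).IsMulLeftInvariant

theorem adjEntry_zero (g : Matrix.unitaryGroup (Fin 2 × Fin 2) ℂ) (c : Fin 4 × Fin 4) :
    adjEntry g 0 c = if c = 0 then 1 else 0 := by
  have h : (g : Matrix (Fin 2 × Fin 2) (Fin 2 × Fin 2) ℂ)ᴴ * (g : Matrix _ _ ℂ) = 1 :=
    Matrix.mem_unitaryGroup_iff'.1 g.2
  rw [adjEntry, tau_zero, Matrix.mul_one, h, ← tau_zero, trace_tau_mul]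
  split_ifs <;> simp

/-- The columns of the adjoint action are orthonormal. -/
theorem sum_adjEntry_mul (g : Matrix.unitaryGroup (Fin 2 × Fin 2) ℂ) (c e : Fin 4 × Fin 4) :
    ∑ a, adjEntry g a c * adjEntry g a e = if c = e then 1 else 0 := by
  have h : (g : Matrix (Fin 2 × Fin 2) (Fin 2 × Fin 2) ℂ)ᴴ * (g : Matrix _ _ ℂ) = 1 :=
    Matrix.mem_unitaryGroup_iff'.1 g.2
  have h1 : ∀ a c, adjEntry g a c =
      (tau a * ((g : Matrix _ _ ℂ) * tau c * (g : Matrix _ _ ℂ)ᴴ)).trace / 4 := by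
    intro a c
    rw [adjEntry, Matrix.trace_mul_comm, Matrix.mul_assoc, Matrix.mul_assoc,
      Matrix.trace_mul_comm]
    simp only [Matrix.mul_assoc]
  have h2 : ∀ a, adjEntry g a c * adjEntry g a e =
      (tau a * ((g : Matrix _ _ ℂ) * tau c * (g : Matrix _ _ ℂ)ᴴ)).trace *
      (tau a * ((g : Matrix _ _ ℂ) * tau e * (g : Matrix _ _ ℂ)ᴴ)).trace / 16 := by
    intro a; rw [h1, h1]; ring
  simp only [h2]
  rw [← Finset.sum_div, sum_trace_tau_mul_tau]
  have h3 : (g : Matrix _ _ ℂ) * tau c * (g : Matrix _ _ ℂ)ᴴ *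
      ((g : Matrix _ _ ℂ) * tau e * (g : Matrix _ _ ℂ)ᴴ) =
      (g : Matrix _ _ ℂ) * (tau c * tau e) * (g : Matrix _ _ ℂ)ᴴ := by
    calc _ = (g : Matrix _ _ ℂ) * tau c * ((g : Matrix _ _ ℂ)ᴴ * (g : Matrix _ _ ℂ)) * tau e *
          (g : Matrix _ _ ℂ)ᴴ := by simp only [Matrix.mul_assoc]
      _ = _ := by rw [h]; simp only [Matrix.mul_assoc, Matrix.one_mul]
  rw [h3, Matrix.trace_mul_comm, ← Matrix.mul_assoc, h, Matrix.one_mul, trace_tau_mul]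
  split_ifs <;> norm_num

/-- The second moments of the adjoint action of a Haar random gate. -/
def adjMoment (a b c e : Fin 4 × Fin 4) : ℂ :=
  ∫ g, adjEntry g a c * adjEntry g b e ∂haarUnitary (Fin 2 × Fin 2)

theorem adjMoment_eq_of_conj (h : Matrix.unitaryGroup (Fin 2 × Fin 2) ℂ)
    {a b a' b' : Fin 4 × Fin 4} {s t : ℂ}
    (ha : (h : Matrix _ _ ℂ)ᴴ * tau a * (h : Matrix _ _ ℂ) = s • tau a')
    (hb : (h : Matrix _ _ ℂ)ᴴ * tau b * (h : Matrix _ _ ℂ) = t • tau b') (c e : Fin 4 × Fin 4) :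
    adjMoment a b c e = s * t * adjMoment a' b' c e := by
  have key : ∀ {a a' : Fin 4 × Fin 4} {s : ℂ},
      (h : Matrix _ _ ℂ)ᴴ * tau a * (h : Matrix _ _ ℂ) = s • tau a' →
      ∀ c g, adjEntry (h * g) a c = s * adjEntry g a' c := by
    intro a a' s ha c g
    have : ((h * g : Matrix.unitaryGroup (Fin 2 × Fin 2) ℂ) : Matrix _ _ ℂ)ᴴ * tau a *
        ((h * g : Matrix.unitaryGroup (Fin 2 × Fin 2) ℂ) : Matrix _ _ ℂ) =
        s • ((g : Matrix _ _ ℂ)ᴴ * tau a' * (g : Matrix _ _ ℂ)) := by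
      calc _ = (g : Matrix _ _ ℂ)ᴴ * ((h : Matrix _ _ ℂ)ᴴ * tau a * (h : Matrix _ _ ℂ)) *
            (g : Matrix _ _ ℂ) := by
            rw [Submonoid.coe_mul, Matrix.conjTranspose_mul]; simp only [Matrix.mul_assoc]
        _ = _ := by rw [ha]; simp
    rw [adjEntry, this, adjEntry, Matrix.mul_smul, Matrix.trace_smul, smul_eq_mul]
    ring
  calc adjMoment a b c e
      = ∫ g, adjEntry (h * g) a c * adjEntry (h * g) b e ∂haarUnitary (Fin 2 × Fin 2) :=
        (integral_mul_left_eq_self _ h).symm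
    _ = ∫ g, s * t * (adjEntry g a' c * adjEntry g b' e) ∂haarUnitary (Fin 2 × Fin 2) := by
        refine integral_congr_ae (Filter.Eventually.of_forall fun g => ?_)
        simp only [key ha, key hb]; ring
    _ = _ := integral_const_mul _ _

/-- A two-qubit Pauli matrix as a gate. -/
def tauGate (p : Fin 4 × Fin 4) : Matrix.unitaryGroup (Fin 2 × Fin 2) ℂ :=
  ⟨tau p, by
    rw [Matrix.mem_unitaryGroup_iff, Matrix.star_eq_conjTranspose, tau_conjTranspose,
      tau_mul_self]⟩

theorem tauGate_conj (r a : Fin 4 × Fin 4) :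
    (tauGate r : Matrix _ _ ℂ)ᴴ * tau a * (tauGate r : Matrix _ _ ℂ) =
      (commSign₂ r a : ℂ) • tau a := by
  change (tau r)ᴴ * tau a * tau r = _
  rw [tau_conjTranspose, tau_comm r a, Matrix.smul_mul, Matrix.mul_assoc, tau_mul_self,
    Matrix.mul_one]

theorem adjMoment_of_ne {a b : Fin 4 × Fin 4} (hab : a ≠ b) (c e : Fin 4 × Fin 4) :
    adjMoment a b c e = 0 := by
  -- some Pauli matrix commutes with one of `τ_a`, `τ_b` and anticommutes with the other
  have hr : ∀ a b : Fin 4 × Fin 4, a ≠ b → ∃ r, commSign₂ r a * commSign₂ r b = -1 := by decide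
  obtain ⟨r, hr⟩ := hr a b hab
  have h := adjMoment_eq_of_conj (tauGate r) (tauGate_conj r a) (tauGate_conj r b) c e
  have h2 : (commSign₂ r a : ℂ) * (commSign₂ r b : ℂ) = -1 := by exact_mod_cast hr
  rw [h2] at h
  linear_combination h / 2

/-- The gate `(τ_a + τ_b) / √2` for anticommuting `τ_a`, `τ_b`; conjugation by it
exchanges them. -/
theorem exists_exchange {a b : Fin 4 × Fin 4} (hab : commSign₂ a b = -1) :
    ∃ h : Matrix.unitaryGroup (Fin 2 × Fin 2) ℂ,
      (h : Matrix _ _ ℂ)ᴴ * tau a * (h : Matrix _ _ ℂ) = (1 : ℂ) • tau b := by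
  have hc : tau a * tau b = -(tau b * tau a) := by rw [tau_comm, hab]; simp
  have hs : ((√2 : ℝ) : ℂ)⁻¹ * ((√2 : ℝ) : ℂ)⁻¹ = 1 / 2 := by
    rw [← mul_inv, ← Complex.ofReal_mul, Real.mul_self_sqrt (by norm_num)]; norm_num
  have hH : ((((√2 : ℝ) : ℂ)⁻¹) • (tau a + tau b))ᴴ = (((√2 : ℝ) : ℂ)⁻¹) • (tau a + tau b) := by
    rw [Matrix.conjTranspose_smul, Matrix.conjTranspose_add, tau_conjTranspose,
      tau_conjTranspose]
    simp
  refine ⟨⟨(((√2 : ℝ) : ℂ)⁻¹) • (tau a + tau b), ?_⟩, ?_⟩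
  · rw [Matrix.mem_unitaryGroup_iff, Matrix.star_eq_conjTranspose, hH, Matrix.smul_mul,
      Matrix.mul_smul, smul_smul, hs, Matrix.add_mul, Matrix.mul_add, Matrix.mul_add,
      tau_mul_self, tau_mul_self, hc]
    have : (1 : Matrix (Fin 2 × Fin 2) (Fin 2 × Fin 2) ℂ) + -(tau b * tau a) +
      (tau b * tau a + 1) = (2 : ℂ) • 1 := by rw [two_smul]; abel
    rw [this, smul_smul]; norm_num
  · change ((((√2 : ℝ) : ℂ)⁻¹) • (tau a + tau b))ᴴ * tau a *
      ((((√2 : ℝ) : ℂ)⁻¹) • (tau a + tau b)) = _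
    rw [hH, Matrix.smul_mul, Matrix.smul_mul, Matrix.mul_smul, smul_smul, hs, Matrix.add_mul,
      Matrix.add_mul, Matrix.mul_add, Matrix.mul_add, tau_mul_self, Matrix.one_mul,
      Matrix.one_mul, Matrix.mul_assoc, tau_mul_self, Matrix.mul_one, Matrix.mul_assoc, hc,
      Matrix.mul_neg, ← Matrix.mul_assoc, tau_mul_self, Matrix.one_mul]
    have : tau a + tau b + (tau b + -tau a) = (2 : ℂ) • tau b := by rw [two_smul]; abel
    rw [this, smul_smul]; norm_num

theorem adjMoment_self_eq {a b : Fin 4 × Fin 4} (ha : a ≠ 0) (hb : b ≠ 0)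
    (c e : Fin 4 × Fin 4) : adjMoment a a c e = adjMoment b b c e := by
  have step : ∀ {a b : Fin 4 × Fin 4}, commSign₂ a b = -1 →
      adjMoment a a c e = adjMoment b b c e := by
    intro a b hab
    obtain ⟨h, hh⟩ := exists_exchange hab
    simpa using adjMoment_eq_of_conj h hh hh c e
  have hr : ∀ a b : Fin 4 × Fin 4, a ≠ 0 → b ≠ 0 →
      ∃ r, commSign₂ a r = -1 ∧ commSign₂ r b = -1 := by decide
  obtain ⟨r, h1, h2⟩ := hr a b ha hb
  exact (step h1).trans (step h2)

/-- Averaged over the gate, the adjoint action sends distinct Pauli matrices to uncorrelated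
combinations, and a nontrivial one to each of the fifteen nontrivial ones with equal weight. -/
theorem adjMoment_eq (a b c e : Fin 4 × Fin 4) :
    adjMoment a b c e =
      if a = b then
        if c = e then
          if a = 0 then if c = 0 then 1 else 0 else if c = 0 then 0 else 1 / 15
        else 0
      else 0 := by
  by_cases hab : a = b
  swap
  · rw [if_neg hab, adjMoment_of_ne hab]
  subst hab
  rw [if_pos rfl]
  have h0 : adjMoment 0 0 c e = if c = e then if c = 0 then 1 else 0 else 0 := by
    simp only [adjMoment, adjEntry_zero]
    split_ifs <;> simp_all
  by_cases ha : a = 0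
  · subst ha
    simpa using h0
  -- the sum over `a` is known from orthogonality of the columns, and its terms with `a ≠ 0` agree
  have hsum : ∑ a, adjMoment a a c e = if c = e then 1 else 0 := by
    simp only [adjMoment]
    rw [← integral_finsetSum _ fun a _ => integrable_adjEntry_mul a a c e]
    simp only [sum_adjEntry_mul]
    simp
  rw [← Finset.add_sum_erase _ _ (Finset.mem_univ (0 : Fin 4 × Fin 4)), h0,
    Finset.sum_congr rfl (fun b hb => adjMoment_self_eq (Finset.ne_of_mem_erase hb) ha c e),
    Finset.sum_const, Finset.card_erase_of_mem (Finset.mem_univ _), Finset.card_univ] at hsum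
  rw [if_neg ha]
  have hcard : Fintype.card (Fin 4 × Fin 4) - 1 = 15 := by simp
  rw [hcard, nsmul_eq_mul] at hsum
  split_ifs at hsum ⊢ <;> push_cast at hsum <;> linear_combination hsum / 15

/-! ### Pauli strings and two-qubit gates acting on them -/

/-- Labels of the Pauli strings on `n` qubits. -/
abbrev PauliStr (n : ℕ) : Type := Fin n → Fin 4

/-- The Pauli string `σ_{P 0} ⊗ ⋯ ⊗ σ_{P (n - 1)}`. -/
def pauli {n : ℕ} (P : PauliStr n) : Matrix (Qubits n) (Qubits n) ℂ :=
  Matrix.of fun x y => ∏ k, sigma (P k) (x k) (y k)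

/-- The Pauli string `P` with its entries at `i` and `j` replaced by `c`. -/
def setPair {n : ℕ} (P : PauliStr n) (i j : Fin n) (c : Fin 4 × Fin 4) : PauliStr n :=
  Function.update (Function.update P i c.1) j c.2

section setPair

variable {n : ℕ} (P : PauliStr n) {i j : Fin n} (c : Fin 4 × Fin 4)

theorem setPair_left (hij : i ≠ j) : setPair P i j c i = c.1 := by
  simp [setPair, Function.update_of_ne hij]

theorem setPair_right : setPair P i j c j = c.2 := by
  simp [setPair]

theorem setPair_of_ne {k : Fin n} (hi : k ≠ i) (hj : k ≠ j) : setPair P i j c k = P k := by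
  simp [setPair, Function.update_of_ne hi, Function.update_of_ne hj]

theorem setPair_self : setPair P i j (P i, P j) = P := by
  simp [setPair]

theorem setPair_setPair (hij : i ≠ j) (c' : Fin 4 × Fin 4) :
    setPair (setPair P i j c) i j c' = setPair P i j c' := by
  funext k
  by_cases hj : k = j
  · subst hj; rw [setPair_right, setPair_right]
  by_cases hi : k = i
  · subst hi; rw [setPair_left _ _ hij, setPair_left _ _ hij]
  · simp only [setPair_of_ne _ _ hi hj]

end setPair

theorem pauli_zero {n : ℕ} : pauli (0 : PauliStr n) = 1 := by
  ext x y
  simp only [pauli, Matrix.of_apply, Pi.zero_apply, sigma_zero, Matrix.one_apply]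
  rw [Finset.prod_ite_zero]
  simp [funext_iff]

theorem prod_eq_mul_mul_prod_erase {n : ℕ} {i j : Fin n} (hij : i ≠ j) (f : Fin n → ℂ) :
    ∏ k, f k = f i * f j * ∏ k ∈ (Finset.univ.erase i).erase j, f k := by
  rw [← Finset.mul_prod_erase _ _ (Finset.mem_univ i),
    ← Finset.mul_prod_erase (Finset.univ.erase i) _ (a := j) (by simp [hij.symm]), mul_assoc]

theorem localMatrix_mul_pauli {n : ℕ} {i j : Fin n} (hij : i ≠ j)
    (g : Matrix (Fin 2 × Fin 2) (Fin 2 × Fin 2) ℂ) (P : PauliStr n) (x z : Qubits n) :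
    (localMatrix i j g * pauli (setPair P i j 0)) x z =
      g (x i, x j) (z i, z j) *
        ∏ k ∈ (Finset.univ.erase i).erase j, sigma (P k) (x k) (z k) := by
  rw [Matrix.mul_apply, Finset.sum_eq_single
    (Function.update (Function.update x i (z i)) j (z j))]
  · simp only [localMatrix, Matrix.of_apply, pauli]
    rw [if_pos (fun k hi hj => by simp [Function.update_of_ne hj, Function.update_of_ne hi]),
      prod_eq_mul_mul_prod_erase hij]
    simp only [setPair_left _ _ hij, setPair_right, Prod.fst_zero, Prod.snd_zero, sigma_zero]
    rw [Finset.prod_congr rfl (g := fun k => sigma (P k) (x k) (z k)) fun k hk => ?_]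
    · have h1 : Function.update (Function.update x i (z i)) j (z j) i = z i := by
        simp [Function.update_of_ne hij]
      have h2 : Function.update (Function.update x i (z i)) j (z j) j = z j := by simp
      rw [h1, h2, Matrix.one_apply_eq, Matrix.one_apply_eq, one_mul, one_mul]
    have hj : k ≠ j := Finset.ne_of_mem_erase hk
    have hi : k ≠ i := Finset.ne_of_mem_erase (Finset.mem_of_mem_erase hk)
    rw [setPair_of_ne _ _ hi hj, Function.update_of_ne hj, Function.update_of_ne hi]
  · intro y _ hy
    simp only [localMatrix, Matrix.of_apply, pauli]
    split_ifs with h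
    · rw [prod_eq_mul_mul_prod_erase hij]
      simp only [setPair_left _ _ hij, setPair_right, Prod.fst_zero, Prod.snd_zero, sigma_zero]
      have : ¬ (y i = z i ∧ y j = z j) := by
        rintro ⟨h1, h2⟩
        refine hy (funext fun k => ?_)
        by_cases hj : k = j
        · subst hj; simp [h2]
        by_cases hi : k = i
        · subst hi; simp [Function.update_of_ne hij, h1]
        · simp [Function.update_of_ne hj, Function.update_of_ne hi, h k hi hj]
      rw [not_and_or] at this
      rcases this with h | h <;> simp [Matrix.one_apply_ne h]
    · rw [zero_mul]
  · simp

theorem sigma_transpose_apply_star (a : Fin 4) (x y : Fin 2) :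
    star (sigma a x y) = sigma a y x := by
  conv_rhs => rw [← sigma_conjTranspose]
  rfl

theorem pauli_conjTranspose {n : ℕ} (P : PauliStr n) : (pauli P)ᴴ = pauli P := by
  ext x y
  simp only [pauli, Matrix.conjTranspose_apply, Matrix.of_apply]
  rw [star_prod]
  simp only [sigma_transpose_apply_star]

/-- A gate commutes with a Pauli string that is trivial on the two qubits of the gate. -/
theorem localMatrix_comm_pauli {n : ℕ} {i j : Fin n} (hij : i ≠ j)
    (g : Matrix (Fin 2 × Fin 2) (Fin 2 × Fin 2) ℂ) (P : PauliStr n) :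
    pauli (setPair P i j 0) * localMatrix i j g = localMatrix i j g * pauli (setPair P i j 0) := by
  have h : pauli (setPair P i j 0) * localMatrix i j g =
      (localMatrix i j gᴴ * pauli (setPair P i j 0))ᴴ := by
    rw [Matrix.conjTranspose_mul, pauli_conjTranspose, localMatrix_conjTranspose,
      Matrix.conjTranspose_conjTranspose]
  rw [h]
  ext x z
  rw [Matrix.conjTranspose_apply, localMatrix_mul_pauli hij, localMatrix_mul_pauli hij,
    star_mul', star_prod]
  simp only [sigma_transpose_apply_star, Matrix.conjTranspose_apply, star_star]

theorem localMatrix_tau_mul_pauli {n : ℕ} {i j : Fin n} (hij : i ≠ j) (P : PauliStr n)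
    (c : Fin 4 × Fin 4) :
    localMatrix i j (tau c) * pauli (setPair P i j 0) = pauli (setPair P i j c) := by
  ext x z
  rw [localMatrix_mul_pauli hij, pauli, Matrix.of_apply, prod_eq_mul_mul_prod_erase hij,
    setPair_left _ _ hij, setPair_right, tau_apply]
  congr 1
  refine Finset.prod_congr rfl fun k hk => ?_
  have hj : k ≠ j := Finset.ne_of_mem_erase hk
  have hi : k ≠ i := Finset.ne_of_mem_erase (Finset.mem_of_mem_erase hk)
  rw [setPair_of_ne _ _ hi hj]

theorem localMatrix_sum_smul {n : ℕ} (i j : Fin n) (r : Fin 4 × Fin 4 → ℂ) :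
    localMatrix i j (∑ c, r c • tau c) = ∑ c, r c • localMatrix i j (tau c) := by
  ext x y
  simp only [localMatrix, Matrix.of_apply, Matrix.sum_apply, Matrix.smul_apply]
  split_ifs
  · rfl
  · simp

/-- The Heisenberg evolution of a Pauli string under a two-qubit gate. -/
theorem localMatrix_conj_pauli {n : ℕ} {i j : Fin n} (hij : i ≠ j)
    (g : Matrix.unitaryGroup (Fin 2 × Fin 2) ℂ) (P : PauliStr n) :
    (localMatrix i j (g : Matrix _ _ ℂ))ᴴ * pauli P * localMatrix i j (g : Matrix _ _ ℂ) =
      ∑ c, adjEntry g (P i, P j) c • pauli (setPair P i j c) := by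
  have hP : pauli P = localMatrix i j (tau (P i, P j)) * pauli (setPair P i j 0) := by
    rw [localMatrix_tau_mul_pauli hij, setPair_self]
  rw [hP, localMatrix_conjTranspose, ← Matrix.mul_assoc, Matrix.mul_assoc,
    localMatrix_comm_pauli hij, ← Matrix.mul_assoc, localMatrix_mul hij, localMatrix_mul hij,
    conj_tau_eq_sum, localMatrix_sum_smul, Finset.sum_mul]
  refine Finset.sum_congr rfl fun c _ => ?_
  rw [Matrix.smul_mul, localMatrix_tau_mul_pauli hij]

/-! ### Pauli coefficients of the evolved state -/

/-- The Pauli coefficient `Tr(P U ρ U†)`. -/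
def pauliCoeff {n : ℕ} (ρ : Matrix (Qubits n) (Qubits n) ℂ) (P : PauliStr n)
    (U : Matrix.unitaryGroup (Qubits n) ℂ) : ℂ :=
  (pauli P * ((U : Matrix _ _ ℂ) * ρ * (U : Matrix _ _ ℂ)ᴴ)).trace

theorem continuous_pauliCoeff {n : ℕ} (ρ : Matrix (Qubits n) (Qubits n) ℂ) (P : PauliStr n) :
    Continuous (pauliCoeff ρ P) := by
  unfold pauliCoeff
  fun_prop

theorem pauliCoeff_localGate_mul {n : ℕ} (ρ : Matrix (Qubits n) (Qubits n) ℂ) (P : PauliStr n)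
    {i j : Fin n} (hij : i ≠ j) (g : Matrix.unitaryGroup (Fin 2 × Fin 2) ℂ)
    (U : Matrix.unitaryGroup (Qubits n) ℂ) :
    pauliCoeff ρ P (localGate i j hij g * U) =
      ∑ c, adjEntry g (P i, P j) c * pauliCoeff ρ (setPair P i j c) U := by
  have hG : ((localGate i j hij g * U : Matrix.unitaryGroup (Qubits n) ℂ) : Matrix _ _ ℂ) =
    localMatrix i j (g : Matrix _ _ ℂ) * (U : Matrix _ _ ℂ) := rfl
  have : pauliCoeff ρ P (localGate i j hij g * U) =
      ((localMatrix i j (g : Matrix _ _ ℂ))ᴴ * pauli P * localMatrix i j (g : Matrix _ _ ℂ) *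
        ((U : Matrix _ _ ℂ) * ρ * (U : Matrix _ _ ℂ)ᴴ)).trace := by
    rw [pauliCoeff, hG, Matrix.conjTranspose_mul, Matrix.mul_assoc _ (pauli P),
      Matrix.mul_assoc (localMatrix i j _)ᴴ, Matrix.trace_mul_comm (localMatrix i j _)ᴴ]
    simp only [Matrix.mul_assoc]
  rw [this, localMatrix_conj_pauli hij, Finset.sum_mul, Matrix.trace_sum]
  refine Finset.sum_congr rfl fun c _ => ?_
  rw [Matrix.smul_mul, Matrix.trace_smul, smul_eq_mul, pauliCoeff]

/-! ### The circuit as one product of gates -/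

/-- The gate at a place of the `d × n` grid, the identity if the brickwork has no gate there. -/
def placeGate {n d : ℕ} (g : GateChoice n d) (p : Fin d × Fin n) :
    Matrix.unitaryGroup (Qubits n) ℂ :=
  if h : HasGate n p.1 p.2 then
    localGate p.2 ⟨p.2 + 1, h.1⟩ (fun e => by simpa using congrArg Fin.val e) (g ⟨p, h⟩)
  else 1

/-- The product of the gates at the places of a list. -/
def gateProd {n d : ℕ} (l : List (Fin d × Fin n)) (g : GateChoice n d) :
    Matrix.unitaryGroup (Qubits n) ℂ :=
  (l.map (placeGate g)).prod

/-- The places of one layer. -/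
def layerPlaces {n d : ℕ} (l : Fin d) : List (Fin d × Fin n) :=
  (List.finRange n).map fun i => (l, i)

theorem brickCircuit_eq_gateProd {n d : ℕ} (g : GateChoice n d) :
    brickCircuit g = gateProd ((List.finRange d).reverse.flatMap layerPlaces) g := by
  have key : ∀ L : List (Fin d),
      (L.map (brickLayer g)).prod = gateProd (L.flatMap layerPlaces) g := by
    intro L
    induction L with
    | nil => simp [gateProd]
    | cons l L ih =>
      rw [List.map_cons, List.prod_cons, ih]
      simp only [gateProd, List.flatMap_cons, List.map_append, List.prod_append]
      congr 1
      simp only [brickLayer, layerPlaces, List.map_map]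
      rfl
  exact key _

theorem continuous_placeGate {n d : ℕ} (p : Fin d × Fin n) :
    Continuous fun g : GateChoice n d => placeGate g p := by
  unfold placeGate
  split_ifs with h
  · exact (continuous_localGate _ _ _).comp (continuous_apply _)
  · exact continuous_const

theorem continuous_gateProd {n d : ℕ} (l : List (Fin d × Fin n)) :
    Continuous (gateProd l : GateChoice n d → Matrix.unitaryGroup (Qubits n) ℂ) :=
  continuous_list_prod _ fun p _ => continuous_placeGate p

theorem placeGate_update_of_ne {n d : ℕ} (g : GateChoice n d) {p : GatePlace n d}
    (h : Matrix.unitaryGroup (Fin 2 × Fin 2) ℂ) {p' : Fin d × Fin n} (hp : p' ≠ p.1) :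
    placeGate (Function.update g p h) p' = placeGate g p' := by
  unfold placeGate
  split_ifs with h'
  · rw [Function.update_of_ne]
    exact fun e => hp (congrArg Subtype.val e)
  · rfl

theorem gateProd_update_of_notMem {n d : ℕ} (g : GateChoice n d) {p : GatePlace n d}
    (h : Matrix.unitaryGroup (Fin 2 × Fin 2) ℂ) {l : List (Fin d × Fin n)} (hp : p.1 ∉ l) :
    gateProd l (Function.update g p h) = gateProd l g := by
  unfold gateProd
  congr 1
  refine List.map_congr_left fun p' hp' => placeGate_update_of_ne g h ?_
  rintro rfl
  exact hp hp'

/-- Resampling one coordinate of a product measure preserves it. -/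
theorem measurePreserving_update_pi {ι : Type*} [Fintype ι] [DecidableEq ι] {X : Type*}
    [MeasurableSpace X] (ν : Measure X) [IsProbabilityMeasure ν] (p : ι) :
    MeasurePreserving (fun q : X × (ι → X) => Function.update q.2 p q.1)
      (ν.prod (Measure.pi fun _ : ι => ν)) (Measure.pi fun _ : ι => ν) := by
  have hm : Measurable fun q : X × (ι → X) => Function.update q.2 p q.1 := by
    refine measurable_pi_iff.2 fun k => ?_
    by_cases hk : k = p
    · subst hk; simpa using measurable_fst
    · simp only [Function.update_of_ne hk]
      exact (measurable_pi_apply k).comp measurable_snd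
  refine ⟨hm, ?_⟩
  refine (Measure.pi_eq fun s hs => ?_).symm
  rw [Measure.map_apply hm (MeasurableSet.univ_pi hs)]
  have : (fun q : X × (ι → X) => Function.update q.2 p q.1) ⁻¹' Set.univ.pi s =
      s p ×ˢ Set.univ.pi (Function.update s p Set.univ) := by
    ext ⟨h, g⟩
    simp only [Set.mem_preimage, Set.mem_univ_pi, Set.mem_prod]
    constructor
    · intro hq
      refine ⟨by simpa using hq p, fun k => ?_⟩
      by_cases hk : k = p
      · subst hk; simp
      · simpa [Function.update_of_ne hk] using hq k
    · rintro ⟨h1, h2⟩ k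
      by_cases hk : k = p
      · subst hk; simpa using h1
      · simpa [Function.update_of_ne hk] using h2 k
  rw [this, Measure.prod_prod, Measure.pi_pi, ← Finset.mul_prod_erase _ _ (Finset.mem_univ p),
    ← Finset.mul_prod_erase _ (fun i => ν (s i)) (Finset.mem_univ p)]
  simp only [Function.update_self, measure_univ, one_mul]
  congr 1
  refine Finset.prod_congr rfl fun k hk => ?_
  rw [Function.update_of_ne (Finset.ne_of_mem_erase hk)]

/-! ### The second moments of the Pauli coefficients -/

/-- The law of the gates of a random brickwork circuit. -/
abbrev gateLaw (n d : ℕ) : Measure (GateChoice n d) :=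
  Measure.pi fun _ : GatePlace n d => haarUnitary (Fin 2 × Fin 2)

/-- The second moment of two Pauli coefficients after the gates at the places of a list. -/
def coeffMoment {n d : ℕ} (ρ : Matrix (Qubits n) (Qubits n) ℂ) (l : List (Fin d × Fin n))
    (P P' : PauliStr n) : ℂ :=
  ∫ g, pauliCoeff ρ P (gateProd l g) * pauliCoeff ρ P' (gateProd l g) ∂gateLaw n d

theorem integrable_coeff_mul {n d : ℕ} (ρ : Matrix (Qubits n) (Qubits n) ℂ)
    (l : List (Fin d × Fin n)) (P P' : PauliStr n) :
    Integrable (fun g => pauliCoeff ρ P (gateProd l g) * pauliCoeff ρ P' (gateProd l g))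
      (gateLaw n d) := by
  have hc : Continuous fun g : GateChoice n d =>
      pauliCoeff ρ P (gateProd l g) * pauliCoeff ρ P' (gateProd l g) :=
    ((continuous_pauliCoeff ρ P).comp (continuous_gateProd l)).mul
      ((continuous_pauliCoeff ρ P').comp (continuous_gateProd l))
  rw [← integrableOn_univ]
  exact hc.continuousOn.integrableOn_compact isCompact_univ

theorem coeffMoment_nil {n d : ℕ} (ρ : Matrix (Qubits n) (Qubits n) ℂ) (P : PauliStr n) :
    coeffMoment (d := d) ρ [] P P = (pauli P * ρ).trace ^ 2 := by
  simp [coeffMoment, gateProd, pauliCoeff, sq]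

theorem coeffMoment_cons_of_not_hasGate {n d : ℕ} (ρ : Matrix (Qubits n) (Qubits n) ℂ)
    {p : Fin d × Fin n} (hp : ¬ HasGate n p.1 p.2) (l : List (Fin d × Fin n))
    (P P' : PauliStr n) : coeffMoment ρ (p :: l) P P' = coeffMoment ρ l P P' := by
  simp [coeffMoment, gateProd, placeGate, hp]

/-- The right neighbour of a qubit. -/
abbrev nextQubit {n l : ℕ} {i : Fin n} (h : HasGate n l i) : Fin n := ⟨i + 1, h.1⟩

theorem ne_nextQubit {n l : ℕ} {i : Fin n} (h : HasGate n l i) : i ≠ nextQubit h :=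
  fun e => by simpa using congrArg Fin.val e

/-- Averaging over the outermost gate of a circuit. -/
theorem coeffMoment_cons {n d : ℕ} (ρ : Matrix (Qubits n) (Qubits n) ℂ) {p : Fin d × Fin n}
    (hp : HasGate n p.1 p.2) {l : List (Fin d × Fin n)} (hl : p ∉ l) (P P' : PauliStr n) :
    coeffMoment ρ (p :: l) P P' =
      ∑ c, ∑ e, adjMoment (P p.2, P (nextQubit hp)) (P' p.2, P' (nextQubit hp)) c e *
        coeffMoment ρ l (setPair P p.2 (nextQubit hp) c) (setPair P' p.2 (nextQubit hp) e) := by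
  let i := p.2
  let j := nextQubit hp
  have hij : i ≠ j := ne_nextQubit hp
  have hmp : MeasurePreserving
      (fun q : Matrix.unitaryGroup (Fin 2 × Fin 2) ℂ × GateChoice n d =>
        Function.update q.2 ⟨p, hp⟩ q.1)
      ((haarUnitary (Fin 2 × Fin 2)).prod (gateLaw n d)) (gateLaw n d) :=
    measurePreserving_update_pi (haarUnitary (Fin 2 × Fin 2)) (⟨p, hp⟩ : GatePlace n d)
  have hexp : ∀ (Q : PauliStr n) (h : Matrix.unitaryGroup (Fin 2 × Fin 2) ℂ)
      (g : GateChoice n d),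
      pauliCoeff ρ Q (gateProd (p :: l) (Function.update g ⟨p, hp⟩ h)) =
        ∑ c, adjEntry h (Q i, Q j) c * pauliCoeff ρ (setPair Q i j c) (gateProd l g) := by
    intro Q h g
    have h1 : gateProd (p :: l) (Function.update g ⟨p, hp⟩ h) =
        localGate i j hij h * gateProd l g := by
      have := gateProd_update_of_notMem g (p := ⟨p, hp⟩) h hl
      rw [gateProd, List.map_cons, List.prod_cons]
      change placeGate _ p * gateProd l _ = _
      rw [this, placeGate, dif_pos hp, Function.update_self]
    rw [h1, pauliCoeff_localGate_mul]
  have hcont : Continuous fun g : GateChoice n d =>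
      pauliCoeff ρ P (gateProd (p :: l) g) * pauliCoeff ρ P' (gateProd (p :: l) g) :=
    ((continuous_pauliCoeff ρ P).comp (continuous_gateProd _)).mul
      ((continuous_pauliCoeff ρ P').comp (continuous_gateProd _))
  have htransfer := integral_map (μ := (haarUnitary (Fin 2 × Fin 2)).prod (gateLaw n d))
    hmp.measurable.aemeasurable hcont.aestronglyMeasurable
  rw [hmp.map_eq] at htransfer
  rw [coeffMoment, htransfer]
  have hfun : ∀ q : Matrix.unitaryGroup (Fin 2 × Fin 2) ℂ × GateChoice n d,
      pauliCoeff ρ P (gateProd (p :: l) (Function.update q.2 ⟨p, hp⟩ q.1)) *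
      pauliCoeff ρ P' (gateProd (p :: l) (Function.update q.2 ⟨p, hp⟩ q.1)) =
      ∑ c, ∑ e, (adjEntry q.1 (P i, P j) c * adjEntry q.1 (P' i, P' j) e) *
        (pauliCoeff ρ (setPair P i j c) (gateProd l q.2) *
          pauliCoeff ρ (setPair P' i j e) (gateProd l q.2)) := by
    intro q
    rw [hexp, hexp, Finset.sum_mul_sum]
    refine Finset.sum_congr rfl fun c _ => Finset.sum_congr rfl fun e _ => ?_
    ring
  simp only [hfun]
  have hint : ∀ c e, Integrable
      (fun q : Matrix.unitaryGroup (Fin 2 × Fin 2) ℂ × GateChoice n d =>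
      (adjEntry q.1 (P i, P j) c * adjEntry q.1 (P' i, P' j) e) *
        (pauliCoeff ρ (setPair P i j c) (gateProd l q.2) *
          pauliCoeff ρ (setPair P' i j e) (gateProd l q.2)))
      ((haarUnitary (Fin 2 × Fin 2)).prod (gateLaw n d)) := fun c e =>
    (integrable_adjEntry_mul _ _ c e).mul_prod (integrable_coeff_mul ρ l _ _)
  rw [integral_finsetSum _ fun c _ => integrable_finsetSum _ fun e _ => hint c e]
  refine Finset.sum_congr rfl fun c _ => ?_
  rw [integral_finsetSum _ fun e _ => hint c e]
  refine Finset.sum_congr rfl fun e _ => ?_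
  exact integral_prod_mul
    (fun h => adjEntry h (P i, P j) c * adjEntry h (P' i, P' j) e)
    (fun g => pauliCoeff ρ (setPair P i j c) (gateProd l g) *
          pauliCoeff ρ (setPair P' i j e) (gateProd l g))

/-- The effect of a Haar random gate on `i`, `j` on the second moments of Pauli coefficients: a
string that is nontrivial there is resampled among the fifteen such ones. -/
def gateStep {n : ℕ} (i j : Fin n) (f : PauliStr n → ℂ) (P : PauliStr n) : ℂ :=
  if (P i, P j) = 0 then f P else
    (∑ c ∈ Finset.univ.erase (0 : Fin 4 × Fin 4), f (setPair P i j c)) / 15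

theorem coeffMoment_cons_self {n d : ℕ} (ρ : Matrix (Qubits n) (Qubits n) ℂ) {p : Fin d × Fin n}
    (hp : HasGate n p.1 p.2) {l : List (Fin d × Fin n)} (hl : p ∉ l) (P : PauliStr n) :
    coeffMoment ρ (p :: l) P P =
      gateStep p.2 (nextQubit hp) (fun Q => coeffMoment ρ l Q Q) P := by
  rw [coeffMoment_cons ρ hp hl, gateStep]
  simp only [adjMoment_eq, if_true, ite_mul, zero_mul, Finset.sum_ite_eq, Finset.mem_univ]
  split_ifs with h
  · simp only [Finset.sum_ite_eq', Finset.mem_univ, if_true, one_mul]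
    rw [← h, setPair_self]
  · rw [← Finset.add_sum_erase _ _ (Finset.mem_univ (0 : Fin 4 × Fin 4)), if_pos rfl, zero_add,
      Finset.sum_div]
    refine Finset.sum_congr rfl fun c hc => ?_
    rw [if_neg (Finset.ne_of_mem_erase hc)]; ring

/-- Once a gate has acted on a site, strings that differ there have uncorrelated coefficients. -/
theorem coeffMoment_of_ne {n d : ℕ} (ρ : Matrix (Qubits n) (Qubits n) ℂ) {k : Fin n} :
    ∀ {l : List (Fin d × Fin n)}, l.Nodup →
      (∃ p ∈ l, ∃ hp : HasGate n p.1 p.2, k = p.2 ∨ k = nextQubit hp) →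
      ∀ {P P' : PauliStr n}, P k ≠ P' k → coeffMoment ρ l P P' = 0
  | [], _, h, _, _, _ => by simp at h
  | p :: l, hl, h, P, P', hk => by
    rw [List.nodup_cons] at hl
    by_cases hp : HasGate n p.1 p.2
    · rw [coeffMoment_cons ρ hp hl.1]
      by_cases htouch : k = p.2 ∨ k = nextQubit hp
      · have : (P p.2, P (nextQubit hp)) ≠ (P' p.2, P' (nextQubit hp)) := by
          rintro e
          rw [Prod.mk.injEq] at e
          rcases htouch with h | h
          · exact hk (by rw [h]; exact e.1)
          · exact hk (by rw [h]; exact e.2)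
        simp [adjMoment_of_ne this]
      · refine Finset.sum_eq_zero fun c _ => Finset.sum_eq_zero fun e _ => ?_
        rw [not_or] at htouch
        rw [coeffMoment_of_ne ρ hl.2 (k := k), mul_zero]
        · obtain ⟨p', hp', h', ht⟩ := h
          rcases List.mem_cons.1 hp' with rfl | hp'
          · exact absurd ht (not_or.2 htouch)
          · exact ⟨p', hp', h', ht⟩
        · rwa [setPair_of_ne _ _ htouch.1 htouch.2, setPair_of_ne _ _ htouch.1 htouch.2]
    · rw [coeffMoment_cons_of_not_hasGate ρ hp]
      refine coeffMoment_of_ne ρ hl.2 ?_ hk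
      obtain ⟨p', hp', h', ht⟩ := h
      rcases List.mem_cons.1 hp' with rfl | hp'
      · exact absurd h' hp
      · exact ⟨p', hp', h', ht⟩

/-! ### The averaged evolution as a linear recursion -/

/-- The effect of the place `p` of the brickwork on second moments of Pauli coefficients. -/
def placeStep {n d : ℕ} (p : Fin d × Fin n) (f : PauliStr n → ℂ) : PauliStr n → ℂ :=
  if h : HasGate n p.1 p.2 then gateStep p.2 (nextQubit h) f else f

/-- The effect of a list of places on second moments of Pauli coefficients. -/
def listStep {n d : ℕ} (l : List (Fin d × Fin n)) (f : PauliStr n → ℂ) : PauliStr n → ℂ :=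
  l.foldr placeStep f

theorem coeffMoment_self {n d : ℕ} (ρ : Matrix (Qubits n) (Qubits n) ℂ) :
    ∀ {l : List (Fin d × Fin n)}, l.Nodup → ∀ P : PauliStr n,
      coeffMoment ρ l P P = listStep l (fun Q => (pauli Q * ρ).trace ^ 2) P
  | [], _, P => coeffMoment_nil ρ P
  | p :: l, hl, P => by
    rw [List.nodup_cons] at hl
    have ih : (fun Q => coeffMoment ρ l Q Q) = listStep l (fun Q => (pauli Q * ρ).trace ^ 2) :=
      funext fun Q => coeffMoment_self ρ hl.2 Q
    rw [listStep, List.foldr_cons, placeStep]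
    split_ifs with hp
    · rw [coeffMoment_cons_self ρ hp hl.1, ih]; rfl
    · rw [coeffMoment_cons_of_not_hasGate ρ hp]
      exact congrFun ih P

theorem setPair_eq_zero {n : ℕ} {P : PauliStr n} {i j : Fin n} (hij : i ≠ j)
    {c : Fin 4 × Fin 4} (h : setPair P i j c = 0) : c = 0 := by
  have h1 := congrFun h i
  have h2 := congrFun h j
  rw [setPair_left _ _ hij] at h1
  rw [setPair_right] at h2
  exact Prod.ext h1 h2

/-- The identity string and the sum of all strings are stationary. -/
theorem gateStep_add_stationary {n : ℕ} {i j : Fin n} (hij : i ≠ j) (f : PauliStr n → ℂ)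
    (a b : ℂ) :
    gateStep i j (fun P => f P + (if P = 0 then a else 0) + b) =
      fun P => gateStep i j f P + (if P = 0 then a else 0) + b := by
  funext P
  simp only [gateStep]
  split_ifs with h h0 h0
  · rfl
  · rfl
  · subst h0; simp at h
  · have : ∀ c ∈ Finset.univ.erase (0 : Fin 4 × Fin 4),
        f (setPair P i j c) + (if setPair P i j c = 0 then a else 0) + b =
          f (setPair P i j c) + b := by
      intro c hc
      rw [if_neg (fun h => Finset.ne_of_mem_erase hc (setPair_eq_zero hij h)), add_zero]
    rw [Finset.sum_congr rfl this, Finset.sum_add_distrib, Finset.sum_const,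
      Finset.card_erase_of_mem (Finset.mem_univ _)]
    have hcard : (Finset.univ : Finset (Fin 4 × Fin 4)).card - 1 = 15 := by simp
    rw [hcard, nsmul_eq_mul]
    push_cast
    ring

theorem listStep_add_stationary {n d : ℕ} (l : List (Fin d × Fin n)) (f : PauliStr n → ℂ)
    (a b : ℂ) :
    listStep l (fun P => f P + (if P = 0 then a else 0) + b) =
      fun P => listStep l f P + (if P = 0 then a else 0) + b := by
  induction l with
  | nil => rfl
  | cons p l ih =>
    simp only [listStep, List.foldr_cons] at ih ⊢
    rw [ih]
    unfold placeStep
    split_ifs with h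
    · exact gateStep_add_stationary (ne_nextQubit h) _ a b
    · rfl

/-! ### Dependence on the support only -/

/-- The value of `f` does not change when a nontrivial entry at `k` is replaced by another one. -/
def SiteInvariant {n : ℕ} (k : Fin n) (f : PauliStr n → ℂ) : Prop :=
  ∀ P P' : PauliStr n, (∀ m, m ≠ k → P m = P' m) → P k ≠ 0 → P' k ≠ 0 → f P = f P'

theorem siteInvariant_gateStep {n : ℕ} {i j : Fin n} (hij : i ≠ j) {k : Fin n}
    (hk : k = i ∨ k = j) (f : PauliStr n → ℂ) : SiteInvariant k (gateStep i j f) := by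
  intro P P' h h1 h2
  have hP : (P i, P j) ≠ 0 := by
    rintro e
    rw [Prod.mk_eq_zero] at e
    rcases hk with rfl | rfl
    exacts [h1 e.1, h1 e.2]
  have hP' : (P' i, P' j) ≠ 0 := by
    rintro e
    rw [Prod.mk_eq_zero] at e
    rcases hk with rfl | rfl
    exacts [h2 e.1, h2 e.2]
  rw [gateStep, gateStep, if_neg hP, if_neg hP']
  congr 1
  refine Finset.sum_congr rfl fun c _ => congrArg f (funext fun m => ?_)
  by_cases hj : m = j
  · subst hj; rw [setPair_right, setPair_right]
  by_cases hi : m = i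
  · subst hi; rw [setPair_left _ _ hij, setPair_left _ _ hij]
  · rw [setPair_of_ne _ _ hi hj, setPair_of_ne _ _ hi hj]
    refine h m ?_
    rcases hk with rfl | rfl <;> assumption

theorem SiteInvariant.gateStep {n : ℕ} {i j : Fin n} (hij : i ≠ j) {k : Fin n}
    (hi : k ≠ i) (hj : k ≠ j) {f : PauliStr n → ℂ} (hf : SiteInvariant k f) :
    SiteInvariant k (gateStep i j f) := by
  intro P P' h h1 h2
  rw [PSQ.gateStep, PSQ.gateStep, h i hi.symm, h j hj.symm]
  split_ifs with h0
  · exact hf P P' h h1 h2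
  · congr 1
    refine Finset.sum_congr rfl fun c _ => hf _ _ (fun m hm => ?_) ?_ ?_
    · by_cases hmj : m = j
      · subst hmj; rw [setPair_right, setPair_right]
      by_cases hmi : m = i
      · subst hmi; rw [setPair_left _ _ hij, setPair_left _ _ hij]
      · rw [setPair_of_ne _ _ hmi hmj, setPair_of_ne _ _ hmi hmj, h m hm]
    · rwa [setPair_of_ne _ _ hi hj]
    · rwa [setPair_of_ne _ _ hi hj]

theorem siteInvariant_listStep {n d : ℕ} {k : Fin n} (f : PauliStr n → ℂ) :
    ∀ {l : List (Fin d × Fin n)},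
      (∃ p ∈ l, ∃ hp : HasGate n p.1 p.2, k = p.2 ∨ k = nextQubit hp) →
      SiteInvariant k (listStep l f)
  | [], h => by simp at h
  | p :: l, h => by
    rw [listStep, List.foldr_cons, placeStep]
    have hrec : (¬ ∃ hp : HasGate n p.1 p.2, k = p.2 ∨ k = nextQubit hp) →
        SiteInvariant k (listStep l f) := by
      intro hp
      refine siteInvariant_listStep f ?_
      obtain ⟨p', hp', h', ht⟩ := h
      rcases List.mem_cons.1 hp' with rfl | hp'
      · exact absurd ⟨h', ht⟩ hp
      · exact ⟨p', hp', h', ht⟩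
    split_ifs with hp
    · by_cases htouch : k = p.2 ∨ k = nextQubit hp
      · exact siteInvariant_gateStep (ne_nextQubit hp) htouch _
      · rw [not_or] at htouch
        exact (hrec fun ⟨_, ht⟩ => not_or.2 htouch ht).gateStep (ne_nextQubit hp)
          htouch.1 htouch.2
    · exact hrec fun ⟨h', _⟩ => hp h'

theorem eq_of_forall_siteInvariant {n : ℕ} {f : PauliStr n → ℂ} (hf : ∀ k, SiteInvariant k f)
    {P P' : PauliStr n} (h : ∀ k, P k = 0 ↔ P' k = 0) : f P = f P' := by
  classical
  have key : ∀ s : Finset (Fin n), f (s.piecewise P' P) = f P := by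
    intro s
    induction s using Finset.induction_on with
    | empty => simp
    | insert k s hk ih =>
      rw [← ih]
      by_cases h0 : P k = 0
      · congr 1
        funext m
        by_cases hm : m = k
        · subst hm; simp [Finset.piecewise, hk, h0, (h m).1 h0]
        · simp [Finset.piecewise, hm]
      · refine hf k _ _ (fun m hm => ?_) ?_ ?_
        · simp [Finset.piecewise, hm]
        · simpa [Finset.piecewise] using fun e => h0 ((h k).2 e)
        · simpa [Finset.piecewise, hk] using h0
  have := key Finset.univ
  rw [Finset.piecewise_univ] at this
  exact this.symm

/-! ### Subsystem purities -/

/-- The Pauli strings supported in `A`. -/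
def strsIn {n : ℕ} (A : Finset (Fin n)) : Finset (PauliStr n) :=
  Fintype.piFinset fun k => if k ∈ A then Finset.univ else {0}

theorem mem_strsIn {n : ℕ} {A : Finset (Fin n)} {P : PauliStr n} :
    P ∈ strsIn A ↔ ∀ k, k ∉ A → P k = 0 := by
  simp only [strsIn, Fintype.mem_piFinset]
  refine forall_congr' fun k => ?_
  split_ifs with h <;> simp [h]

/-- If `f` gives the squares of the Pauli coefficients of a state, this is the purity of its
reduction to `A`. -/
def purity {n : ℕ} (f : PauliStr n → ℂ) (A : Finset (Fin n)) : ℂ :=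
  (∑ P ∈ strsIn A, f P) / 2 ^ A.card

/-- Splits a sum over strings supported in `A` by the entries at `i` and `j`. -/
theorem sum_strsIn {n : ℕ} {i j : Fin n} (hij : i ≠ j) (A : Finset (Fin n))
    (F : PauliStr n → ℂ) :
    ∑ P ∈ strsIn A, F P = ∑ P ∈ strsIn (A \ {i, j}),
      ∑ c with (i ∉ A → c.1 = 0) ∧ (j ∉ A → c.2 = 0), F (setPair P i j c) := by
  rw [Finset.sum_sigma']
  symm
  refine Finset.sum_bij' (fun q _ => setPair q.1 i j q.2)
    (fun P _ => ⟨setPair P i j 0, (P i, P j)⟩) ?_ ?_ ?_ ?_ ?_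
  · rintro ⟨P, c⟩ hq
    simp only [Finset.mem_sigma, Finset.mem_filter, Finset.mem_univ, true_and, mem_strsIn] at hq
    rw [mem_strsIn]
    intro k hk
    by_cases hj : k = j
    · subst hj; rw [setPair_right]; exact hq.2.2 hk
    by_cases hi : k = i
    · subst hi; rw [setPair_left _ _ hij]; exact hq.2.1 hk
    · rw [setPair_of_ne _ _ hi hj]
      exact hq.1 k (by simp [hk])
  · intro P hP
    rw [mem_strsIn] at hP
    simp only [Finset.mem_sigma, Finset.mem_filter, Finset.mem_univ, true_and, mem_strsIn]
    refine ⟨fun k hk => ?_, hP i, hP j⟩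
    by_cases hj : k = j
    · subst hj; rw [setPair_right]; rfl
    by_cases hi : k = i
    · subst hi; rw [setPair_left _ _ hij]; rfl
    · rw [setPair_of_ne _ _ hi hj]
      exact hP k fun h => hk (by simp [h, hi, hj])
  · rintro ⟨P, c⟩ hq
    simp only [Finset.mem_sigma, mem_strsIn] at hq
    have hP : setPair P i j 0 = P := by
      have h1 : P i = 0 := hq.1 i (by simp)
      have h2 : P j = 0 := hq.1 j (by simp)
      have h3 : (0 : Fin 4 × Fin 4) = (P i, P j) := by rw [h1, h2]; rfl
      rw [h3, setPair_self]
    simp only [setPair_setPair _ _ hij, hP, setPair_left _ _ hij, setPair_right]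
  · intro P _
    simp only [setPair_setPair _ _ hij, setPair_self]
  · intros; rfl

theorem sum_strsIn_gateStep {n : ℕ} {i j : Fin n} (hij : i ≠ j) (A : Finset (Fin n))
    (f : PauliStr n → ℂ) {m : ℕ}
    (hm : (Finset.univ.filter fun c : Fin 4 × Fin 4 =>
      (i ∉ A → c.1 = 0) ∧ (j ∉ A → c.2 = 0)).card = m + 1) :
    ∑ P ∈ strsIn A, gateStep i j f P =
      (1 - m / 15) * ∑ P ∈ strsIn (A \ {i, j}), f P +
        m / 15 * ∑ P ∈ strsIn (A ∪ {i, j}), f P := by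
  have hu : (A ∪ {i, j}) \ {i, j} = A \ {i, j} := Finset.union_sdiff_right _ _
  rw [sum_strsIn hij A, sum_strsIn hij (A ∪ {i, j}), hu, Finset.mul_sum, Finset.mul_sum,
    ← Finset.sum_add_distrib]
  refine Finset.sum_congr rfl fun P hP => ?_
  rw [mem_strsIn] at hP
  have hP0 : setPair P i j 0 = P := by
    have h1 : P i = 0 := hP i (by simp)
    have h2 : P j = 0 := hP j (by simp)
    have h3 : (0 : Fin 4 × Fin 4) = (P i, P j) := by rw [h1, h2]; rfl
    rw [h3, setPair_self]
  have hstep : ∀ c, gateStep i j f (setPair P i j c) =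
      if c = 0 then f P else
        (∑ c ∈ Finset.univ.erase (0 : Fin 4 × Fin 4), f (setPair P i j c)) / 15 := by
    intro c
    rw [gateStep, setPair_left _ _ hij, setPair_right]
    by_cases hc : c = 0
    · subst hc; simp [hP0]
    · rw [if_neg hc, if_neg hc]
      simp only [setPair_setPair _ _ hij]
  have hfull : (Finset.univ.filter fun c : Fin 4 × Fin 4 =>
      (i ∉ A ∪ {i, j} → c.1 = 0) ∧ (j ∉ A ∪ {i, j} → c.2 = 0)) = Finset.univ := by
    simp
  have h0 : (0 : Fin 4 × Fin 4) ∈ Finset.univ.filter fun c : Fin 4 × Fin 4 =>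
      (i ∉ A → c.1 = 0) ∧ (j ∉ A → c.2 = 0) := by simp
  rw [hfull, ← Finset.add_sum_erase _ _ h0, hstep, if_pos rfl,
    Finset.sum_congr rfl (fun c hc => by rw [hstep, if_neg (Finset.ne_of_mem_erase hc)]),
    Finset.sum_const, Finset.card_erase_of_mem h0, hm,
    ← Finset.add_sum_erase Finset.univ _ (Finset.mem_univ (0 : Fin 4 × Fin 4)), hP0]
  rw [nsmul_eq_mul, Nat.add_sub_cancel]
  ring

/-- A gate on two sites on the same side of the boundary of `A` does not change the purity. -/
theorem purity_gateStep_of_iff {n : ℕ} {i j : Fin n} (hij : i ≠ j) {A : Finset (Fin n)}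
    (hA : i ∈ A ↔ j ∈ A) (f : PauliStr n → ℂ) :
    purity (gateStep i j f) A = purity f A := by
  rw [purity, purity]
  congr 1
  by_cases hi : i ∈ A
  · have hj := hA.1 hi
    rw [sum_strsIn_gateStep hij A f (m := 15) (by simp [hi, hj])]
    have : A ∪ {i, j} = A := by
      rw [Finset.union_eq_left]
      intro k hk
      rcases Finset.mem_insert.1 hk with rfl | hk
      · exact hi
      · rw [Finset.mem_singleton.1 hk]; exact hj
    rw [this]
    push_cast
    ring
  · have hj : j ∉ A := fun h => hi (hA.2 h)
    rw [sum_strsIn_gateStep hij A f (m := 0) (by simp [hi, hj]; decide)]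
    have : A \ {i, j} = A := by
      rw [Finset.sdiff_eq_self_iff_disjoint, Finset.disjoint_right]
      intro k hk
      rcases Finset.mem_insert.1 hk with rfl | hk
      · exact hi
      · rw [Finset.mem_singleton.1 hk]; exact hj
    rw [this]
    push_cast
    ring

/-- A gate across the boundary of `A` moves the boundary to either of its sides, with
weights `2/5`. -/
theorem purity_gateStep_of_not_iff {n : ℕ} {i j : Fin n} (hij : i ≠ j) {A : Finset (Fin n)}
    (hA : ¬(i ∈ A ↔ j ∈ A)) (f : PauliStr n → ℂ) :
    purity (gateStep i j f) A = 2 / 5 * (purity f (A ∪ {i, j}) + purity f (A \ {i, j})) := by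
  have hcard : (Finset.univ.filter fun c : Fin 4 × Fin 4 =>
      (i ∉ A → c.1 = 0) ∧ (j ∉ A → c.2 = 0)).card = 3 + 1 := by
    by_cases hi : i ∈ A
    · have hj : j ∉ A := fun h => hA (iff_of_true hi h)
      simp only [hi, hj, not_true_eq_false, false_implies, true_and, not_false_eq_true,
        true_implies]
      decide
    · have hj : j ∈ A := by by_contra h; exact hA (iff_of_false hi h)
      simp only [hi, hj, not_true_eq_false, false_implies, and_true, not_false_eq_true,
        true_implies]
      decide
  have hsize : (A ∪ {i, j}).card = A.card + 1 ∧ (A \ {i, j}).card + 1 = A.card := by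
    by_cases hi : i ∈ A
    · have hj : j ∉ A := fun h => hA (iff_of_true hi h)
      have h1 : A ∪ {i, j} = insert j A := by
        ext k; simp only [Finset.mem_union, Finset.mem_insert, Finset.mem_singleton]
        constructor
        · rintro (h | rfl | rfl) <;> simp_all
        · rintro (rfl | h) <;> simp_all
      have h2 : A \ {i, j} = A.erase i := by
        ext k; simp only [Finset.mem_sdiff, Finset.mem_insert, Finset.mem_singleton,
          Finset.mem_erase, not_or]
        constructor
        · rintro ⟨h, h', -⟩; exact ⟨h', h⟩
        · rintro ⟨h', h⟩; exact ⟨h, h', fun e => hj (e ▸ h)⟩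
      rw [h1, h2, Finset.card_insert_of_notMem hj]
      exact ⟨rfl, Finset.card_erase_add_one hi⟩
    · have hj : j ∈ A := by by_contra h; exact hA (iff_of_false hi h)
      have h1 : A ∪ {i, j} = insert i A := by
        ext k; simp only [Finset.mem_union, Finset.mem_insert, Finset.mem_singleton]
        constructor
        · rintro (h | rfl | rfl) <;> simp_all
        · rintro (rfl | h) <;> simp_all
      have h2 : A \ {i, j} = A.erase j := by
        ext k; simp only [Finset.mem_sdiff, Finset.mem_insert, Finset.mem_singleton,
          Finset.mem_erase, not_or]
        constructor
        · rintro ⟨h, -, h'⟩; exact ⟨h', h⟩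
        · rintro ⟨h', h⟩; exact ⟨h, fun e => hi (e ▸ h), h'⟩
      rw [h1, h2, Finset.card_insert_of_notMem hi]
      exact ⟨rfl, Finset.card_erase_add_one hj⟩
  rw [purity, purity, purity, sum_strsIn_gateStep hij A f hcard, hsize.1, ← hsize.2]
  have : (2 : ℂ) ^ (A \ {i, j}).card ≠ 0 := by positivity
  rw [pow_succ, pow_succ]
  field_simp
  push_cast
  ring

/-! ### Contraction of the nonstationary part of the purities -/

/-- Layer `l` has a gate across the boundary of `A`. -/
def LayerCuts (n l : ℕ) (A : Finset (Fin n)) : Prop :=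
  ∃ i : Fin n, ∃ h : HasGate n l i, ¬(i ∈ A ↔ nextQubit h ∈ A)

theorem exists_adjacent_of_ne {n : ℕ} {A : Finset (Fin n)} (h0 : A ≠ ∅) (h1 : A ≠ Finset.univ) :
    ∃ i : Fin n, ∃ h : i.1 + 1 < n, ¬(i ∈ A ↔ (⟨i + 1, h⟩ : Fin n) ∈ A) := by
  by_contra! hcon
  have key : ∀ m (hm : m < n), ((⟨m, hm⟩ : Fin n) ∈ A ↔ (⟨0, by omega⟩ : Fin n) ∈ A) := by
    intro m
    induction m with
    | zero => intro hm; rfl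
    | succ m ih => intro hm; rw [← ih (by omega)]; exact (hcon ⟨m, by omega⟩ hm).symm
  obtain ⟨a, ha⟩ := Finset.nonempty_iff_ne_empty.2 h0
  refine h1 (Finset.eq_univ_of_forall fun b => ?_)
  exact (key b b.2).2 ((key a a.2).1 ha)

/-- Two consecutive layers together have gates across every pair of neighbours. -/
theorem layerCuts_or {n : ℕ} (l : ℕ) {A : Finset (Fin n)} (h0 : A ≠ ∅) (h1 : A ≠ Finset.univ) :
    LayerCuts n l A ∨ LayerCuts n (l + 1) A := by
  obtain ⟨i, h, hi⟩ := exists_adjacent_of_ne h0 h1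
  rcases Nat.mod_two_eq_zero_or_one (i.1 + l) with hp | hp
  · exact Or.inl ⟨i, ⟨h, by omega⟩, hi⟩
  · exact Or.inr ⟨i, ⟨h, by omega⟩, hi⟩

theorem not_cut_of_union {n : ℕ} {l : ℕ} {i j : Fin n} (hi : HasGate n l i) (hj : HasGate n l j)
    {A : Finset (Fin n)} (h : j = i ∨ (j ∈ A ↔ nextQubit hj ∈ A)) :
    (j ∈ A ∪ {i, nextQubit hi} ↔ nextQubit hj ∈ A ∪ {i, nextQubit hi}) ∧
      (j ∈ A \ {i, nextQubit hi} ↔ nextQubit hj ∈ A \ {i, nextQubit hi}) := by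
  by_cases hij : j = i
  · subst hij; simp
  · have h1 := hi.2
    have h2 := hj.2
    have hne : (j : ℕ) ≠ i := fun e => hij (Fin.ext e)
    have e1 : j ∉ ({i, nextQubit hi} : Finset (Fin n)) := by
      simp only [Finset.mem_insert, Finset.mem_singleton, Fin.ext_iff, nextQubit]; omega
    have e2 : nextQubit hj ∉ ({i, nextQubit hi} : Finset (Fin n)) := by
      simp only [Finset.mem_insert, Finset.mem_singleton, Fin.ext_iff, nextQubit]; omega
    have h := h.resolve_left hij
    simp only [Finset.mem_union, Finset.mem_sdiff, e1, e2, or_false, not_false_eq_true, and_true]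
    exact ⟨h, h⟩

/-- One layer: after it, purities are averages, with total weight at most `4/5` if some gate
crosses the boundary, of purities of sets whose boundary no gate of the layer crosses. The set `Z`
collects the gates that have already been averaged over. -/
theorem norm_purity_layer_le {n d : ℕ} (l : Fin d) (f : PauliStr n → ℂ) {M : ℝ} :
    ∀ (I : List (Fin n)) (Z : Set (Fin n)),
      (∀ A, (∀ i, (i ∈ Z ∨ i ∈ I) → ∀ h : HasGate n l i, (i ∈ A ↔ nextQubit h ∈ A)) →
        ‖purity f A‖ ≤ M) →
      ∀ A, (∀ i ∈ Z, ∀ h : HasGate n l i, (i ∈ A ↔ nextQubit h ∈ A)) →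
        ‖purity (listStep (I.map fun i => (l, i)) f) A‖ ≤ M ∧
        ((∃ i ∈ I, ∃ h : HasGate n l i, ¬(i ∈ A ↔ nextQubit h ∈ A)) →
          ‖purity (listStep (I.map fun i => (l, i)) f) A‖ ≤ 4 / 5 * M)
  | [], Z, hf, A, hA => by
    refine ⟨hf A fun i hi => hA i (by simpa using hi), fun h => by simp at h⟩
  | i :: I, Z, hf, A, hA => by
    have ih := norm_purity_layer_le l f I (insert i Z) fun A h => hf A fun k hk h' => by
      refine h k ?_ h'
      simp only [List.mem_cons] at hk
      simp only [Set.mem_insert_iff]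
      tauto
    have hM : 0 ≤ M := (norm_nonneg _).trans (hf ∅ (by simp))
    rw [List.map_cons, listStep, List.foldr_cons, placeStep]
    change ‖purity (if h : HasGate n l i then gateStep i (nextQubit h)
      (listStep (I.map fun i => (l, i)) f) else listStep (I.map fun i => (l, i)) f) A‖ ≤ M ∧
      (_ → ‖purity (if h : HasGate n l i then gateStep i (nextQubit h)
      (listStep (I.map fun i => (l, i)) f) else listStep (I.map fun i => (l, i)) f) A‖ ≤ _)
    have hpass : (∀ h : HasGate n l i, (i ∈ A ↔ nextQubit h ∈ A)) →
        (‖purity (listStep (I.map fun i => (l, i)) f) A‖ ≤ M ∧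
        ((∃ k ∈ i :: I, ∃ h : HasGate n l k, ¬(k ∈ A ↔ nextQubit h ∈ A)) →
          ‖purity (listStep (I.map fun i => (l, i)) f) A‖ ≤ 4 / 5 * M)) := by
      intro hi
      have ihA := ih A (by rintro k (rfl | hk); exacts [hi, hA k hk])
      refine ⟨ihA.1, fun ⟨k, hk, h, hc⟩ => ihA.2 ⟨k, ?_, h, hc⟩⟩
      rcases List.mem_cons.1 hk with rfl | hk
      · exact absurd (hi h) hc
      · exact hk
    split_ifs with h
    · by_cases hi : (i ∈ A ↔ nextQubit h ∈ A)
      · rw [purity_gateStep_of_iff (ne_nextQubit h) hi]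
        exact hpass fun _ => hi
      · rw [purity_gateStep_of_not_iff (ne_nextQubit h) hi]
        have hu := (ih (A ∪ {i, nextQubit h}) fun k hk h' => (not_cut_of_union h h'
          ((Set.mem_insert_iff.1 hk).imp id fun hk => hA k hk h')).1).1
        have hd := (ih (A \ {i, nextQubit h}) fun k hk h' => (not_cut_of_union h h'
          ((Set.mem_insert_iff.1 hk).imp id fun hk => hA k hk h')).2).1
        have : ‖(2 / 5 : ℂ) * (purity (listStep (I.map fun i => (l, i)) f) (A ∪ {i, nextQubit h}) +
            purity (listStep (I.map fun i => (l, i)) f) (A \ {i, nextQubit h}))‖ ≤ 4 / 5 * M := by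
          rw [norm_mul]
          have h25 : ‖(2 / 5 : ℂ)‖ = 2 / 5 := by norm_num
          rw [h25]
          have := norm_add_le
            (purity (listStep (I.map fun i => (l, i)) f) (A ∪ {i, nextQubit h}))
            (purity (listStep (I.map fun i => (l, i)) f) (A \ {i, nextQubit h}))
          linarith
        exact ⟨this.trans (by linarith), fun _ => this⟩
    · exact hpass fun h' => absurd h' h

theorem purity_listStep_of_trivial {n d : ℕ} {A : Finset (Fin n)}
    (hA : A = ∅ ∨ A = Finset.univ) (f : PauliStr n → ℂ) (l : List (Fin d × Fin n)) :
    purity (listStep l f) A = purity f A := by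
  induction l with
  | nil => rfl
  | cons p l ih =>
    rw [← ih, listStep, List.foldr_cons, placeStep]
    split_ifs with h
    · refine purity_gateStep_of_iff (ne_nextQubit h) ?_ _
      rcases hA with rfl | rfl <;> simp
    · rfl

/-- The layers `t - 1, …, 0`. -/
def layersBelow {d : ℕ} : (t : ℕ) → t ≤ d → List (Fin d)
  | 0, _ => []
  | t + 1, h => ⟨t, h⟩ :: layersBelow t (Nat.le_of_succ_le h)

theorem layersBelow_eq (d : ℕ) : layersBelow d le_rfl = (List.finRange d).reverse := by
  have key : ∀ t (ht : t ≤ d), (layersBelow t ht).map Fin.val = (List.range t).reverse := by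
    intro t
    induction t with
    | zero => intro _; rfl
    | succ t ih => intro ht; simp [layersBelow, ih, List.range_succ]
  refine List.map_injective_iff.2 Fin.val_injective ?_
  rw [key, List.map_reverse, List.map_coe_finRange_eq_range]

theorem listStep_layersBelow_succ {n d t : ℕ} (ht : t + 1 ≤ d) (f : PauliStr n → ℂ) :
    listStep ((layersBelow (t + 1) ht).flatMap layerPlaces) f =
      listStep ((List.finRange n).map fun i => (⟨t, ht⟩, i))
        (listStep ((layersBelow t (Nat.le_of_succ_le ht)).flatMap layerPlaces) f) := by
  simp only [layersBelow, List.flatMap_cons, listStep, List.foldr_append, layerPlaces]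

/-- Every layer shrinks the purities of the sets that the next layer does not cut by `4/5`:
such a set, if nontrivial, is cut by the layer itself. -/
theorem norm_purity_layersBelow_le {n d : ℕ} {f : PauliStr n → ℂ} {M : ℝ}
    (h0 : purity f ∅ = 0) (h1 : purity f Finset.univ = 0) (hM : ∀ A, ‖purity f A‖ ≤ M) :
    ∀ (t : ℕ) (ht : t ≤ d) (A : Finset (Fin n)), ¬ LayerCuts n t A →
      ‖purity (listStep ((layersBelow t ht).flatMap layerPlaces) f) A‖ ≤ (4 / 5) ^ t * M
  | 0, _, A, _ => by simpa [layersBelow, listStep] using hM A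
  | t + 1, ht, A, hA => by
    have hM0 : 0 ≤ M := (norm_nonneg _).trans (hM ∅)
    by_cases htriv : A = ∅ ∨ A = Finset.univ
    · rw [purity_listStep_of_trivial htriv]
      have : purity f A = 0 := by rcases htriv with rfl | rfl <;> assumption
      rw [this, norm_zero]
      positivity
    · rw [not_or] at htriv
      obtain ⟨i, h, hi⟩ := (layerCuts_or t htriv.1 htriv.2).resolve_right hA
      rw [listStep_layersBelow_succ]
      have := (norm_purity_layer_le ⟨t, ht⟩
        (listStep ((layersBelow t (Nat.le_of_succ_le ht)).flatMap layerPlaces) f)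
        (M := (4 / 5) ^ t * M) (List.finRange n) ∅ (fun A hA => ?_) A (by simp)).2
        ⟨i, List.mem_finRange i, h, hi⟩
      · refine this.trans (le_of_eq ?_)
        rw [pow_succ]; ring
      · refine norm_purity_layersBelow_le h0 h1 hM t _ A ?_
        rintro ⟨i, h, hi⟩
        exact hi (hA i (Or.inr (List.mem_finRange i)) h)

/-- Decay of the nonstationary part of the purities in a brickwork circuit. -/
theorem norm_purity_brick_le {n d : ℕ} {f : PauliStr n → ℂ} {M : ℝ}
    (h0 : purity f ∅ = 0) (h1 : purity f Finset.univ = 0) (hM : ∀ A, ‖purity f A‖ ≤ M)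
    (A : Finset (Fin n)) :
    ‖purity (listStep (((List.finRange d).reverse).flatMap layerPlaces) f) A‖ ≤
      5 / 4 * (4 / 5) ^ d * M := by
  have hM0 : 0 ≤ M := (norm_nonneg _).trans (hM ∅)
  rw [← layersBelow_eq]
  cases d with
  | zero =>
    simp only [layersBelow, List.flatMap_nil, listStep, List.foldr_nil]
    exact (hM A).trans (by linarith)
  | succ t =>
    rw [listStep_layersBelow_succ]
    have := (norm_purity_layer_le (⟨t, Nat.lt_succ_self t⟩ : Fin (t + 1))
        (listStep ((layersBelow t (Nat.le_of_succ_le le_rfl)).flatMap layerPlaces) f)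
        (M := (4 / 5) ^ t * M) (List.finRange n) ∅ (fun A hA => ?_) A (by simp)).1
    · refine this.trans (le_of_eq ?_)
      rw [pow_succ]; ring
    · refine norm_purity_layersBelow_le h0 h1 hM t _ A ?_
      rintro ⟨i, h, hi⟩
      exact hi (hA i (Or.inr (List.mem_finRange i)) h)

/-! ### From purities back to Pauli coefficients -/

/-- Inclusion–exclusion for the strings with support exactly `B`. -/
theorem sum_support_eq {n : ℕ} (f : PauliStr n → ℂ) (B : Finset (Fin n)) :
    ∑ P ∈ (Finset.univ : Finset (PauliStr n)) with (∀ k, P k = 0 ↔ k ∉ B), f P =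
      ∑ A ∈ B.powerset, (-1) ^ (B \ A).card * (2 ^ A.card * purity f A) := by
  have hind : ∀ P : PauliStr n, (if ∀ k, P k = 0 ↔ k ∉ B then (1 : ℂ) else 0) =
      ∑ A ∈ B.powerset, (-1) ^ (B \ A).card * if P ∈ strsIn A then 1 else 0 := by
    intro P
    by_cases hP : P ∈ strsIn B
    · have h1 : (if ∀ k, P k = 0 ↔ k ∉ B then (1 : ℂ) else 0) =
          ∏ k ∈ B, ((1 : ℂ) + (-if P k = 0 then 1 else 0)) := by
        have hk : ∀ k, (1 : ℂ) + (-if P k = 0 then 1 else 0) = if P k ≠ 0 then 1 else 0 := by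
          intro k; split_ifs <;> simp_all
        simp only [hk]
        rw [Finset.prod_ite_zero]
        simp only [Finset.prod_const_one]
        refine if_congr ⟨fun h k hk h0 => (h k).1 h0 hk, fun h k => ⟨fun h0 hk => h k hk h0,
          fun hk => mem_strsIn.1 hP k hk⟩⟩ rfl rfl
      rw [h1, Finset.prod_add]
      refine Finset.sum_congr rfl fun A hA => ?_
      rw [Finset.prod_const_one, one_mul, Finset.prod_neg, Finset.prod_ite_zero]
      congr 1
      simp only [Finset.prod_const_one]
      refine if_congr ?_ rfl rfl
      rw [mem_strsIn]
      refine ⟨fun h k hk => ?_, fun h k hk => h k (Finset.mem_sdiff.1 hk).2⟩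
      by_cases hkB : k ∈ B
      · exact h k (Finset.mem_sdiff.2 ⟨hkB, hk⟩)
      · exact mem_strsIn.1 hP k hkB
    · rw [if_neg fun h => hP (mem_strsIn.2 fun k hk => (h k).2 hk)]
      refine (Finset.sum_eq_zero fun A hA => ?_).symm
      rw [if_neg, mul_zero]
      exact fun h => hP (mem_strsIn.2 fun k hk => mem_strsIn.1 h k fun hkA =>
        hk (Finset.mem_powerset.1 hA hkA))
  have hpur : ∀ A, (2 : ℂ) ^ A.card * purity f A = ∑ P, (if P ∈ strsIn A then 1 else 0) * f P := by
    intro A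
    rw [purity, mul_div_cancel₀ _ (by positivity)]
    simp [Finset.sum_ite_mem]
  rw [Finset.sum_filter]
  have : ∀ P, (if ∀ k, P k = 0 ↔ k ∉ B then f P else 0) =
      ∑ A ∈ B.powerset, (-1) ^ (B \ A).card * ((if P ∈ strsIn A then 1 else 0) * f P) := by
    intro P
    simp only [← mul_assoc]
    rw [← Finset.sum_mul, ← hind]
    split_ifs <;> simp
  simp only [this, hpur, Finset.mul_sum]
  rw [Finset.sum_comm]

theorem card_support_eq {n : ℕ} (B : Finset (Fin n)) :
    ((Finset.univ : Finset (PauliStr n)).filter fun P => ∀ k, P k = 0 ↔ k ∉ B).card =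
      3 ^ B.card := by
  have : ((Finset.univ : Finset (PauliStr n)).filter fun P => ∀ k, P k = 0 ↔ k ∉ B) =
      Fintype.piFinset fun k => if k ∈ B then Finset.univ.erase 0 else {0} := by
    ext P
    simp only [Finset.mem_filter, Finset.mem_univ, true_and, Fintype.mem_piFinset]
    refine forall_congr' fun k => ?_
    by_cases hk : k ∈ B <;> simp [hk]
  rw [this, Fintype.card_piFinset]
  have : ∀ k, (if k ∈ B then (Finset.univ.erase 0 : Finset (Fin 4)) else {0}).card =
      if k ∈ B then 3 else 1 := by
    intro k; split_ifs <;> simp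
  simp only [this]
  rw [Finset.prod_ite_mem]
  simp

theorem norm_le_of_norm_purity_le {n : ℕ} {f : PauliStr n → ℂ} (hf : ∀ k, SiteInvariant k f)
    {M : ℝ} (hM : ∀ A, ‖purity f A‖ ≤ M) (P : PauliStr n) : ‖f P‖ ≤ M := by
  classical
  set B : Finset (Fin n) := Finset.univ.filter fun k => P k ≠ 0
  have hB : ∀ k, P k = 0 ↔ k ∉ B := fun k => by simp [B]
  have h1 : (3 : ℂ) ^ B.card * f P =
      ∑ A ∈ B.powerset, (-1) ^ (B \ A).card * (2 ^ A.card * purity f A) := by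
    rw [← sum_support_eq, Finset.sum_congr rfl (g := fun _ => f P), Finset.sum_const,
      card_support_eq, nsmul_eq_mul]
    · push_cast; rfl
    · intro P' hP'
      refine eq_of_forall_siteInvariant hf fun k => ?_
      rw [hB k, (Finset.mem_filter.1 hP').2 k]
  have h2 : (3 : ℝ) ^ B.card * ‖f P‖ ≤ 3 ^ B.card * M := by
    calc (3 : ℝ) ^ B.card * ‖f P‖ = ‖(3 : ℂ) ^ B.card * f P‖ := by simp
      _ ≤ ∑ A ∈ B.powerset, (2 : ℝ) ^ A.card * M := by
          rw [h1]
          refine (norm_sum_le _ _).trans (Finset.sum_le_sum fun A _ => ?_)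
          rw [norm_mul, norm_mul, norm_pow, norm_pow, norm_neg, norm_one, one_pow, one_mul,
            Complex.norm_ofNat]
          exact mul_le_mul_of_nonneg_left (hM A) (by positivity)
      _ = 3 ^ B.card * M := by
          rw [← Finset.sum_mul]
          congr 1
          have := Finset.sum_pow_mul_eq_add_pow (2 : ℝ) 1 B
          simp only [one_pow, mul_one] at this
          rw [this]; norm_num
  exact le_of_mul_le_mul_left h2 (by positivity)

/-! ### Parseval identity and the purities of a state -/

/-- The Pauli strings supported in `A` resolve the swap of the qubits in `A`. -/
theorem sum_pauli_mul_pauli {n : ℕ} (A : Finset (Fin n)) (x y z w : Qubits n) :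
    ∑ P ∈ strsIn A, pauli P x y * pauli P z w =
      if y = A.piecewise z x ∧ w = A.piecewise x z then 2 ^ A.card else 0 := by
  have h1 : ∀ P : PauliStr n, pauli P x y * pauli P z w =
      ∏ k, (sigma (P k) (x k) (y k) * sigma (P k) (z k) (w k)) := by
    intro P
    rw [Finset.prod_mul_distrib]; rfl
  have h2 : ∀ k, ∑ a ∈ (if k ∈ A then Finset.univ else {0}),
      sigma a (x k) (y k) * sigma a (z k) (w k) =
      if y k = A.piecewise z x k ∧ w k = A.piecewise x z k then
        (if k ∈ A then (2 : ℂ) else 1) else 0 := by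
    intro k
    by_cases hk : k ∈ A
    · simp only [sum_sigma_mul_sigma, Finset.piecewise, hk, if_true]
      exact if_congr ⟨fun h => ⟨h.2, h.1.symm⟩, fun h => ⟨h.2.symm, h.1⟩⟩ rfl rfl
    · simp only [Finset.sum_singleton, Finset.piecewise, hk, if_false, sigma_zero,
        Matrix.one_apply, mul_ite, mul_one, mul_zero]
      by_cases e1 : x k = y k <;> by_cases e2 : z k = w k <;>
        simp [e1, e2, eq_comm]
  simp only [h1]
  rw [strsIn, ← Finset.prod_univ_sum (fun k => if k ∈ A then Finset.univ else {0})
    (fun k a => sigma a (x k) (y k) * sigma a (z k) (w k))]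
  simp only [h2]
  rw [Finset.prod_ite_zero, Finset.prod_ite_mem]
  simp [funext_iff, forall_and]

theorem sum_trace_pauli_mul {n : ℕ} (A : Finset (Fin n)) (M M' : Matrix (Qubits n) (Qubits n) ℂ) :
    ∑ P ∈ strsIn A, (pauli P * M).trace * (pauli P * M').trace =
      2 ^ A.card * ∑ x, ∑ z, M (A.piecewise z x) x * M' (A.piecewise x z) z := by
  have h : ∀ P : PauliStr n, (pauli P * M).trace * (pauli P * M').trace =
      ∑ x, ∑ z, ∑ y, ∑ w, (pauli P x y * pauli P z w) * (M y x * M' w z) := by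
    intro P
    simp only [Matrix.trace, Matrix.diag, Matrix.mul_apply, Finset.sum_mul_sum]
    refine Finset.sum_congr rfl fun x _ => Finset.sum_congr rfl fun z _ =>
      Finset.sum_congr rfl fun y _ => Finset.sum_congr rfl fun w _ => ?_
    ring
  simp only [h]
  rw [Finset.sum_comm, Finset.mul_sum]
  refine Finset.sum_congr rfl fun x _ => ?_
  rw [Finset.sum_comm, Finset.mul_sum]
  refine Finset.sum_congr rfl fun z _ => ?_
  rw [Finset.sum_comm]
  have : ∀ y, ∑ P ∈ strsIn A, ∑ w, pauli P x y * pauli P z w * (M y x * M' w z) =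
      ∑ w, if y = A.piecewise z x ∧ w = A.piecewise x z then
        2 ^ A.card * (M y x * M' w z) else 0 := by
    intro y
    rw [Finset.sum_comm]
    refine Finset.sum_congr rfl fun w _ => ?_
    rw [← Finset.sum_mul, sum_pauli_mul_pauli, ite_mul, zero_mul]
  simp only [this, ite_and]
  simp

theorem strsIn_univ {n : ℕ} : strsIn (Finset.univ : Finset (Fin n)) = Finset.univ := by
  ext P; simp [mem_strsIn]

theorem sum_trace_pauli_mul_univ {n : ℕ} (M M' : Matrix (Qubits n) (Qubits n) ℂ) :
    ∑ P, (pauli P * M).trace * (pauli P * M').trace = 2 ^ n * (M * M').trace := by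
  have h := sum_trace_pauli_mul Finset.univ M M'
  rw [strsIn_univ] at h
  rw [h, Finset.card_univ, Fintype.card_fin, Finset.sum_comm]
  simp only [Finset.piecewise_univ]
  rfl

theorem norm_sq_le_of_posSemidef {ι : Type*} [Fintype ι] [DecidableEq ι] {ρ : Matrix ι ι ℂ}
    (h : ρ.PosSemidef) (i j : ι) : ‖ρ i j‖ ^ 2 ≤ (ρ i i).re * (ρ j j).re := by
  have hd := (h.submatrix ![i, j]).det_nonneg
  rw [Matrix.det_fin_two] at hd
  simp only [Matrix.submatrix_apply, Matrix.cons_val_zero, Matrix.cons_val_one] at hd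
  have hs : ρ j i = star (ρ i j) := (h.1.apply j i).symm
  have hi : ρ i i = ((ρ i i).re : ℂ) := (Complex.conj_eq_iff_re.1 (h.1.apply i i)).symm
  have hj : ρ j j = ((ρ j j).re : ℂ) := (Complex.conj_eq_iff_re.1 (h.1.apply j j)).symm
  have hm : ρ i j * star (ρ i j) = ((‖ρ i j‖ ^ 2 : ℝ) : ℂ) := by
    rw [Complex.star_def, Complex.mul_conj, Complex.normSq_eq_norm_sq]
  rw [hs, hm, hi, hj, ← Complex.ofReal_mul, ← Complex.ofReal_sub] at hd
  have := Complex.zero_le_real.1 hd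
  simpa using this

theorem diag_re_nonneg {ι : Type*} [Fintype ι] [DecidableEq ι] {ρ : Matrix ι ι ℂ}
    (h : ρ.PosSemidef) (i : ι) : 0 ≤ (ρ i i).re :=
  (Complex.le_def.1 h.diag_nonneg).1

theorem norm_mul_norm_le_of_posSemidef {ι : Type*} [Fintype ι] [DecidableEq ι]
    {ρ : Matrix ι ι ℂ} (h : ρ.PosSemidef) (x y z w : ι) :
    ‖ρ y x‖ * ‖ρ w z‖ ≤
      ((ρ x x).re * (ρ z z).re + (ρ y y).re * (ρ w w).re) / 2 := by
  have h1 := norm_sq_le_of_posSemidef h y x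
  have h2 := norm_sq_le_of_posSemidef h w z
  have hx := diag_re_nonneg h x
  have hy := diag_re_nonneg h y
  have hz := diag_re_nonneg h z
  have hw := diag_re_nonneg h w
  refine le_of_sq_le_sq ?_ (by positivity)
  calc (‖ρ y x‖ * ‖ρ w z‖) ^ 2 = ‖ρ y x‖ ^ 2 * ‖ρ w z‖ ^ 2 := by ring
    _ ≤ ((ρ y y).re * (ρ x x).re) * ((ρ w w).re * (ρ z z).re) :=
        mul_le_mul h1 h2 (by positivity) (by positivity)
    _ ≤ _ := by
        nlinarith [sq_nonneg ((ρ x x).re * (ρ z z).re - (ρ y y).re * (ρ w w).re)]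

theorem piecewise_involutive {n : ℕ} (A : Finset (Fin n)) :
    Function.Involutive fun q : Qubits n × Qubits n =>
      (A.piecewise q.2 q.1, A.piecewise q.1 q.2) := by
  rintro ⟨x, z⟩
  refine Prod.ext (funext fun k => ?_) (funext fun k => ?_) <;>
    by_cases hk : k ∈ A <;> simp [Finset.piecewise, hk]

theorem sum_diag_re_mul {n : ℕ} {ρ : Matrix (Qubits n) (Qubits n) ℂ} (htr : ρ.trace = 1) :
    ∑ q : Qubits n × Qubits n, (ρ q.1 q.1).re * (ρ q.2 q.2).re = 1 := by
  have h : ∑ x, (ρ x x).re = 1 := by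
    have := congrArg Complex.re htr
    simpa [Matrix.trace] using this
  rw [Fintype.sum_prod_type]
  change ∑ x, ∑ z, (ρ x x).re * (ρ z z).re = 1
  rw [← Finset.sum_mul_sum, h, one_mul]

/-- The subsystem purities of a state are at most `1`. -/
theorem norm_purity_state_le {n : ℕ} {ρ : Matrix (Qubits n) (Qubits n) ℂ} (h : ρ.PosSemidef)
    (htr : ρ.trace = 1) (A : Finset (Fin n)) :
    ‖purity (fun P => (pauli P * ρ).trace ^ 2) A‖ ≤ 1 := by
  have h1 : purity (fun P => (pauli P * ρ).trace ^ 2) A =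
      ∑ q : Qubits n × Qubits n,
        ρ (A.piecewise q.2 q.1) q.1 * ρ (A.piecewise q.1 q.2) q.2 := by
    simp only [purity, sq]
    rw [sum_trace_pauli_mul, mul_div_cancel_left₀ _ (by positivity), Fintype.sum_prod_type]
  rw [h1]
  calc _ ≤ ∑ q : Qubits n × Qubits n, ((ρ q.1 q.1).re * (ρ q.2 q.2).re +
        (ρ (A.piecewise q.2 q.1) (A.piecewise q.2 q.1)).re *
          (ρ (A.piecewise q.1 q.2) (A.piecewise q.1 q.2)).re) / 2 := by
        refine (norm_sum_le _ _).trans (Finset.sum_le_sum fun q _ => ?_)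
        rw [norm_mul]
        exact norm_mul_norm_le_of_posSemidef h _ _ _ _
    _ = 1 := by
        rw [← Finset.sum_div, Finset.sum_add_distrib, sum_diag_re_mul htr]
        have := Equiv.sum_comp ((piecewise_involutive A).toPerm)
          (fun q : Qubits n × Qubits n => (ρ q.1 q.1).re * (ρ q.2 q.2).re)
        rw [sum_diag_re_mul htr] at this
        simp only [Function.Involutive.coe_toPerm] at this
        rw [this]; norm_num

theorem purity_add_stationary {n : ℕ} (f : PauliStr n → ℂ) (a b : ℂ) (A : Finset (Fin n)) :
    purity (fun P => f P + (if P = 0 then a else 0) + b) A =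
      purity f A + a / 2 ^ A.card + b * 2 ^ A.card := by
  have h0 : (0 : PauliStr n) ∈ strsIn A := mem_strsIn.2 fun _ _ => rfl
  have hc : (strsIn A).card = 4 ^ A.card := by
    have : ∀ k, (if k ∈ A then (Finset.univ : Finset (Fin 4)) else {0}).card =
        if k ∈ A then 4 else 1 := by
      intro k; split_ifs <;> simp
    rw [strsIn, Fintype.card_piFinset]
    simp only [this]
    rw [Finset.prod_ite_mem]
    simp
  rw [purity, purity, Finset.sum_add_distrib, Finset.sum_add_distrib, Finset.sum_ite_eq',
    if_pos h0, Finset.sum_const, hc, nsmul_eq_mul, add_div, add_div]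
  congr 1
  have h2 : (2 : ℂ) ^ A.card ≠ 0 := by positivity
  rw [div_eq_iff h2]
  push_cast
  rw [mul_assoc, ← mul_pow]
  norm_num
  ring

/-! ### The second moment of expectation values -/

/-- The places of a brickwork circuit, the outermost gate first. -/
abbrev brickPlaces (n d : ℕ) : List (Fin d × Fin n) :=
  (List.finRange d).reverse.flatMap layerPlaces

theorem nodup_brickPlaces (n d : ℕ) : (brickPlaces n d).Nodup :=
  List.Nodup.product (List.nodup_reverse.2 (List.nodup_finRange d)) (List.nodup_finRange n)

theorem exists_gate_touching {n d : ℕ} (hn : 2 ≤ n) (hd : 2 ≤ d) (k : Fin n) :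
    ∃ p ∈ brickPlaces n d, ∃ hp : HasGate n p.1 p.2, k = p.2 ∨ k = nextQubit hp := by
  have hmem : ∀ p : Fin d × Fin n, p ∈ brickPlaces n d := by
    rintro ⟨l, i⟩
    simp [brickPlaces, layerPlaces]
  by_cases hk : k.1 + 1 < n
  · refine ⟨(⟨k % 2, by omega⟩, k), hmem _, ⟨hk, ?_⟩, Or.inl rfl⟩
    change k.1 % 2 = k.1 % 2 % 2
    omega
  · refine ⟨(⟨(k - 1) % 2, by omega⟩, ⟨k - 1, by omega⟩), hmem _, ⟨?_, ?_⟩, Or.inr (Fin.ext ?_)⟩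
    · change k.1 - 1 + 1 < n
      omega
    · change (k.1 - 1) % 2 = (k.1 - 1) % 2 % 2
      omega
    · change k.1 = k.1 - 1 + 1
      omega

/-- Every nontrivial Pauli coefficient of the output state of a random brickwork circuit
has small second moment. -/
theorem norm_coeffMoment_le {n d : ℕ} (hn : 2 ≤ n) (hd : 2 ≤ d)
    {ρ : Matrix (Qubits n) (Qubits n) ℂ} (h : ρ.PosSemidef) (htr : ρ.trace = 1)
    {P : PauliStr n} (hP : P ≠ 0) :
    ‖coeffMoment ρ (brickPlaces n d) P P‖ ≤ 4 / 3 / 2 ^ n + 5 * (4 / 5) ^ d := by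
  set w : PauliStr n → ℂ := fun P => (pauli P * ρ).trace ^ 2 with hw
  set N : ℝ := 2 ^ n with hN
  have hN4 : 4 ≤ N := by
    calc (4 : ℝ) = 2 ^ 2 := by norm_num
      _ ≤ 2 ^ n := pow_le_pow_right₀ (by norm_num) hn
  have hNC : ((N : ℝ) : ℂ) = 2 ^ n := by rw [hN]; push_cast; rfl
  have hNC0 : (N : ℂ) ≠ 0 := by exact_mod_cast (by linarith : N ≠ 0)
  set p : ℂ := purity w Finset.univ with hp
  have hp1 : ‖p‖ ≤ 1 := norm_purity_state_le h htr _
  -- the weights of the two stationary solutions, fixed by the purities of `∅` and of all qubits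
  set b : ℂ := (p - (N : ℂ)⁻¹) / ((N - N⁻¹ : ℝ) : ℂ) with hb
  set a : ℂ := 1 - b with ha
  have hNN : 0 < N - N⁻¹ := by
    have : N⁻¹ ≤ 1 := inv_le_one_of_one_le₀ (by linarith)
    linarith
  have hbN : ‖b‖ ≤ 4 / 3 / N := by
    rw [hb, norm_div, Complex.norm_of_nonneg hNN.le, div_le_iff₀ hNN]
    have h1 : ‖p - (N : ℂ)⁻¹‖ ≤ 1 + N⁻¹ := by
      refine (norm_sub_le _ _).trans (add_le_add hp1 (le_of_eq ?_))
      rw [norm_inv, Complex.norm_of_nonneg (by linarith)]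
    refine h1.trans ?_
    have hN0 : 0 < N := by linarith
    have : 4 / 3 / N * (N - N⁻¹) - (1 + N⁻¹) = (N + 1) * (N - 4) / (3 * N ^ 2) := by
      field_simp; ring
    have h2 : 0 ≤ (N + 1) * (N - 4) / (3 * N ^ 2) :=
      div_nonneg (mul_nonneg (by linarith) (by linarith)) (by positivity)
    linarith
  have hb3 : ‖b‖ ≤ 1 / 3 := hbN.trans (by rw [div_le_iff₀ (by linarith)]; linarith)
  have ha4 : ‖a‖ ≤ 4 / 3 := by
    have := norm_sub_le (1 : ℂ) b
    rw [norm_one] at this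
    linarith
  set f : PauliStr n → ℂ := fun P => w P - (if P = 0 then a else 0) - b with hf
  have hwf : w = fun P => f P + (if P = 0 then a else 0) + b := by
    funext P; simp only [hf]; ring
  have hpur : ∀ A, purity f A = purity w A - a / 2 ^ A.card - b * 2 ^ A.card := by
    intro A
    have := purity_add_stationary f a b A
    rw [← hwf] at this
    rw [this]; ring
  have h0 : purity f ∅ = 0 := by
    have : purity w ∅ = 1 := by
      have : strsIn (∅ : Finset (Fin n)) = {0} := by
        ext P; simp [mem_strsIn, funext_iff]
      simp [purity, this, hw, pauli_zero, htr]
    rw [hpur, this, ha]; simp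
  have h1 : purity f Finset.univ = 0 := by
    have hne : ((N - N⁻¹ : ℝ) : ℂ) ≠ 0 := by exact_mod_cast hNN.ne'
    have hbe : b * ((N - N⁻¹ : ℝ) : ℂ) = p - (N : ℂ)⁻¹ := div_mul_cancel₀ _ hne
    push_cast at hbe
    rw [hpur, ← hp, Finset.card_univ, Fintype.card_fin, ← hNC, ha, div_eq_mul_inv]
    linear_combination -hbe
  have hM : ∀ A, ‖purity f A‖ ≤ 4 := by
    intro A
    have h1 : ‖a / 2 ^ A.card‖ ≤ 4 / 3 := by
      rw [norm_div, norm_pow, Complex.norm_ofNat]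
      exact (div_le_self (norm_nonneg _) (one_le_pow₀ (by norm_num))).trans ha4
    have h2 : ‖b * 2 ^ A.card‖ ≤ 4 / 3 := by
      rw [norm_mul, norm_pow, Complex.norm_ofNat]
      have : (2 : ℝ) ^ A.card ≤ N :=
        pow_le_pow_right₀ (by norm_num) (by simpa using A.card_le_univ)
      calc ‖b‖ * 2 ^ A.card ≤ 4 / 3 / N * N :=
            mul_le_mul hbN this (by positivity) (by positivity)
        _ = 4 / 3 := div_mul_cancel₀ _ (by linarith)
    rw [hpur]
    have h3 := norm_sub_le (purity w A - a / 2 ^ A.card) (b * 2 ^ A.card)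
    have h4 := norm_sub_le (purity w A) (a / 2 ^ A.card)
    have h5 : ‖purity w A‖ ≤ 1 := norm_purity_state_le h htr A
    linarith
  have hfin := norm_le_of_norm_purity_le
    (fun k => siteInvariant_listStep (k := k) f (exists_gate_touching hn hd k))
    (norm_purity_brick_le (d := d) h0 h1 hM) P
  rw [coeffMoment_self ρ (nodup_brickPlaces n d) P]
  change ‖listStep _ w P‖ ≤ _
  rw [hwf, listStep_add_stationary]
  simp only [if_neg hP, add_zero]
  refine (norm_add_le _ _).trans ?_
  linarith

/-- The expectation value `Tr(O U ρ U†)`. -/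
def obsValue {n : ℕ} (ρ O : Matrix (Qubits n) (Qubits n) ℂ)
    (U : Matrix.unitaryGroup (Qubits n) ℂ) : ℂ :=
  (O * ((U : Matrix _ _ ℂ) * ρ * (U : Matrix _ _ ℂ)ᴴ)).trace

theorem continuous_obsValue {n : ℕ} (ρ O : Matrix (Qubits n) (Qubits n) ℂ) :
    Continuous (obsValue ρ O) := by
  unfold obsValue
  fun_prop

theorem ofReal_re_trace_mul {ι : Type*} [Fintype ι] {A B : Matrix ι ι ℂ}
    (hA : A.IsHermitian) (hB : B.IsHermitian) : (((A * B).trace.re : ℝ) : ℂ) = (A * B).trace := by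
  refine Complex.conj_eq_iff_re.1 ?_
  rw [← Complex.star_def, ← Matrix.trace_conjTranspose, Matrix.conjTranspose_mul, hA.eq, hB.eq,
    Matrix.trace_mul_comm]

theorem integral_obsValue_sq_le {n d : ℕ} (hn : 2 ≤ n) (hd : 2 ≤ d)
    {ρ O : Matrix (Qubits n) (Qubits n) ℂ} (h : ρ.PosSemidef) (htr : ρ.trace = 1)
    (hO : O.IsHermitian) (hO0 : O.trace = 0) (hO2 : (O * O).trace.re ≤ 2 ^ n) :
    ∫ U, (obsValue ρ O U).re ^ 2 ∂(RQC n d) ≤ 4 / 3 / 2 ^ n + 5 * (4 / 5) ^ d := by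
  set B : ℝ := 4 / 3 / 2 ^ n + 5 * (4 / 5) ^ d
  have hB : 0 ≤ B := by positivity
  have hreal : ∀ U : Matrix.unitaryGroup (Qubits n) ℂ,
      (((obsValue ρ O U).re ^ 2 : ℝ) : ℂ) = obsValue ρ O U ^ 2 := by
    intro U
    have := ofReal_re_trace_mul hO (h.mul_mul_conjTranspose_same (U : Matrix _ _ ℂ)).1
    rw [obsValue]
    push_cast
    rw [this]
  have hexp : ∀ U : Matrix.unitaryGroup (Qubits n) ℂ, obsValue ρ O U ^ 2 =
      (∑ P, ∑ P', (pauli P * O).trace * (pauli P' * O).trace *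
        (pauliCoeff ρ P U * pauliCoeff ρ P' U)) / (2 ^ n) ^ 2 := by
    intro U
    have h1 := sum_trace_pauli_mul_univ O ((U : Matrix _ _ ℂ) * ρ * (U : Matrix _ _ ℂ)ᴴ)
    have h2 : obsValue ρ O U = (∑ P, (pauli P * O).trace * pauliCoeff ρ P U) / 2 ^ n := by
      rw [eq_div_iff (by positivity), mul_comm]
      exact h1.symm
    rw [h2, div_pow, sq (∑ P, _), Finset.sum_mul_sum]
    refine congrArg (fun s : ℂ => s / (2 ^ n) ^ 2) ?_
    refine Finset.sum_congr rfl fun P _ => Finset.sum_congr rfl fun P' _ => ?_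
    ring
  have hint : ((∫ U, (obsValue ρ O U).re ^ 2 ∂(RQC n d) : ℝ) : ℂ) =
      (∑ P, (pauli P * O).trace ^ 2 * coeffMoment ρ (brickPlaces n d) P P) / (2 ^ n) ^ 2 := by
    rw [← integral_complex_ofReal]
    simp only [hreal]
    have hcont : Continuous fun U => obsValue ρ O U ^ 2 := (continuous_obsValue ρ O).pow 2
    rw [RQC, integral_map (measurable_brickCircuit n d).aemeasurable hcont.aestronglyMeasurable]
    simp only [hexp, brickCircuit_eq_gateProd]
    rw [integral_div]
    refine congrArg (fun s : ℂ => s / (2 ^ n) ^ 2) ?_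
    rw [integral_finsetSum _ fun P _ => integrable_finsetSum _ fun P' _ =>
      (integrable_coeff_mul ρ (brickPlaces n d) P P').const_mul _]
    refine Finset.sum_congr rfl fun P _ => ?_
    rw [integral_finsetSum _ fun P' _ =>
      (integrable_coeff_mul ρ (brickPlaces n d) P P').const_mul _, Finset.sum_eq_single P]
    · rw [integral_const_mul, sq]; rfl
    · intro P' _ hne
      rw [integral_const_mul]
      obtain ⟨k, hk⟩ := Function.ne_iff.1 hne.symm
      have := coeffMoment_of_ne ρ (nodup_brickPlaces n d) (exists_gate_touching hn hd k) hk
      rw [coeffMoment] at this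
      rw [this, mul_zero]
    · simp
  have hsum : ∑ P, ‖(pauli P * O).trace‖ ^ 2 = 2 ^ n * (O * O).trace.re := by
    have h1 : ∀ P : PauliStr n, ((‖(pauli P * O).trace‖ ^ 2 : ℝ) : ℂ) =
        (pauli P * O).trace * (pauli P * O).trace := by
      intro P
      rw [← ofReal_re_trace_mul (pauli_conjTranspose P) hO]
      rw [Complex.norm_real, Real.norm_eq_abs, sq_abs]
      push_cast; ring
    have h2 := sum_trace_pauli_mul_univ O O
    simp only [← h1] at h2
    rw [← ofReal_re_trace_mul hO hO] at h2
    exact_mod_cast h2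
  have hle : ‖((∫ U, (obsValue ρ O U).re ^ 2 ∂(RQC n d) : ℝ) : ℂ)‖ ≤ B := by
    rw [hint, norm_div, div_le_iff₀ (by simp)]
    calc _ ≤ ∑ P, ‖(pauli P * O).trace‖ ^ 2 * B := by
          refine (norm_sum_le _ _).trans (Finset.sum_le_sum fun P _ => ?_)
          rw [norm_mul, norm_pow]
          by_cases hP : P = 0
          · subst hP; simp [pauli_zero, hO0]
          · exact mul_le_mul_of_nonneg_left (norm_coeffMoment_le hn hd h htr hP) (by positivity)
      _ = 2 ^ n * (O * O).trace.re * B := by rw [← Finset.sum_mul, hsum]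
      _ ≤ 2 ^ n * 2 ^ n * B := by gcongr
      _ = B * ‖((2 : ℂ) ^ n) ^ 2‖ := by simp; ring
  rw [Complex.norm_real] at hle
  exact (le_abs_self _).trans hle

/-- The variance bound: in a random brickwork circuit the expectation value of an observable
concentrates around its value in the maximally mixed state. -/
theorem integral_sub_sq_le {n d : ℕ} (hn : 2 ≤ n) (hd : 2 ≤ d)
    {ρ O : Matrix (Qubits n) (Qubits n) ℂ} (h : ρ.PosSemidef) (htr : ρ.trace = 1)
    (hO : O.IsHermitian) (hO2 : (O * O).trace.re ≤ 2 ^ n) :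
    ∫ U, ((obsValue ρ O U).re - O.trace.re / 2 ^ n) ^ 2 ∂(RQC n d) ≤
      4 / 3 / 2 ^ n + 5 * (4 / 5) ^ d := by
  set t : ℝ := O.trace.re / 2 ^ n with ht
  have htO : O.trace = ((O.trace.re : ℝ) : ℂ) := by
    have := ofReal_re_trace_mul hO (Matrix.isHermitian_one (n := Qubits n) (α := ℂ))
    rw [Matrix.mul_one] at this
    exact this.symm
  have hcard : (1 : Matrix (Qubits n) (Qubits n) ℂ).trace = 2 ^ n := by
    simp [Matrix.trace_one]
  set O' : Matrix (Qubits n) (Qubits n) ℂ := O - (t : ℂ) • 1 with hO'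
  have hherm : O'.IsHermitian := by
    rw [Matrix.IsHermitian, hO', Matrix.conjTranspose_sub, hO.eq, Matrix.conjTranspose_smul,
      Matrix.conjTranspose_one]
    simp
  have htr0 : O'.trace = 0 := by
    rw [hO', Matrix.trace_sub, Matrix.trace_smul, hcard, htO, ht, smul_eq_mul]
    push_cast
    rw [div_mul_cancel₀ _ (by positivity), sub_self]
  have hsq : (O' * O').trace.re ≤ 2 ^ n := by
    have : (O' * O').trace = (O * O).trace - t * O.trace - t * O'.trace := by
      have : O' * O' = O * O - (t : ℂ) • O - (t : ℂ) • O' := by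
        conv_lhs => rw [hO']
        simp only [hO', Matrix.sub_mul, Matrix.mul_sub, Matrix.smul_mul, Matrix.mul_smul,
          Matrix.one_mul, Matrix.mul_one]
      rw [this, Matrix.trace_sub, Matrix.trace_sub, Matrix.trace_smul, Matrix.trace_smul]; rfl
    rw [this, htr0, mul_zero, sub_zero, Complex.sub_re, Complex.re_ofReal_mul]
    have : 0 ≤ t * O.trace.re := by
      rw [ht, div_mul_eq_mul_div]
      exact div_nonneg (mul_self_nonneg _) (by positivity)
    linarith
  refine le_trans (le_of_eq ?_) (integral_obsValue_sq_le hn hd h htr hherm htr0 hsq)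
  refine integral_congr_ae (Filter.Eventually.of_forall fun U => ?_)
  have hU : ((U : Matrix _ _ ℂ) * ρ * (U : Matrix _ _ ℂ)ᴴ).trace = 1 := by
    rw [Matrix.trace_mul_comm, ← Matrix.mul_assoc, ← Matrix.star_eq_conjTranspose,
      Matrix.mem_unitaryGroup_iff'.1 U.2, Matrix.one_mul, htr]
  have : obsValue ρ O' U = obsValue ρ O U - t := by
    rw [obsValue, hO', Matrix.sub_mul, Matrix.trace_sub, Matrix.smul_mul, Matrix.one_mul,
      Matrix.trace_smul, hU, smul_eq_mul, mul_one, obsValue]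
  simp only [this, Complex.sub_re, Complex.ofReal_re]

/-! ### Trace norm, observables and processes -/

theorem Channel.posSemidef_map {ι : Type*} [Fintype ι] (E : Channel ι)
    {ρ : Matrix ι ι ℂ} (h : ρ.PosSemidef) : (E.toLin ρ).PosSemidef := by
  have h1 := E.completelyPositive 1 _ (h.submatrix (Prod.fst : ι × Fin 1 → ι))
  exact h1.submatrix fun i => (i, 0)

theorem posSemidef_single {ι : Type*} [DecidableEq ι] (x : ι) :
    (Matrix.single x x (1 : ℂ)).PosSemidef := by
  have : Matrix.single x x (1 : ℂ) = Matrix.diagonal (Pi.single x 1) := by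
    rw [Matrix.diagonal_single]
  rw [this]
  refine Matrix.PosSemidef.diagonal fun i => ?_
  by_cases h : i = x
  · subst h; simp
  · simp [h]

section Processes

variable {ι : Type*} [Fintype ι] [DecidableEq ι]

/-- The trace norm dominates the pairing with a unitary matrix. -/
theorem norm_trace_mul_le_traceNorm {Z : Matrix ι ι ℂ} (hZ : Z * Zᴴ = 1) (X : Matrix ι ι ℂ) :
    ‖(Z * X).trace‖ ≤ traceNorm X := by
  set hX := Matrix.isHermitian_conjTranspose_mul_self X
  -- the columns of `V` are an orthonormal eigenbasis of `Xᴴ X`, so those of `X * V` have the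
  -- norms `√λ_i`
  set V : Matrix ι ι ℂ := hX.eigenvectorUnitary.1
  have hVV : V * Vᴴ = 1 := Matrix.mem_unitaryGroup_iff.1 hX.eigenvectorUnitary.2
  have hVV' : Vᴴ * V = 1 := Matrix.mem_unitaryGroup_iff'.1 hX.eigenvectorUnitary.2
  have hdiag : (X * V)ᴴ * (X * V) = Matrix.diagonal (fun i => ((hX.eigenvalues i : ℝ) : ℂ)) := by
    have := hX.conjStarAlgAut_star_eigenvectorUnitary
    rw [Unitary.conjStarAlgAut_star_apply] at this
    rw [Matrix.conjTranspose_mul, Matrix.mul_assoc, ← Matrix.mul_assoc Xᴴ, ← Matrix.mul_assoc]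
    exact this
  have hcol : ∀ (W : Matrix ι ι ℂ) (i : ι), (Wᴴ * W) i i = ((∑ k, ‖W k i‖ ^ 2 : ℝ) : ℂ) := by
    intro W i
    rw [Matrix.mul_apply]
    push_cast
    refine Finset.sum_congr rfl fun k _ => ?_
    rw [Matrix.conjTranspose_apply, Complex.star_def, Complex.conj_mul']
  have hW : ∀ i, ∑ k, ‖(X * V) k i‖ ^ 2 = hX.eigenvalues i := by
    intro i
    have := hcol (X * V) i
    rw [hdiag, Matrix.diagonal_apply_eq] at this
    exact_mod_cast this.symm
  have hY : ∀ i, ∑ k, ‖(Zᴴ * V) k i‖ ^ 2 = 1 := by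
    intro i
    have h1 : (Zᴴ * V)ᴴ * (Zᴴ * V) = 1 := by
      rw [Matrix.conjTranspose_mul, Matrix.conjTranspose_conjTranspose, Matrix.mul_assoc,
        ← Matrix.mul_assoc Z, hZ, Matrix.one_mul, hVV']
    have := hcol (Zᴴ * V) i
    rw [h1, Matrix.one_apply_eq] at this
    exact_mod_cast this.symm
  have htr : (Z * X).trace = ∑ i, ∑ k, star ((Zᴴ * V) k i) * (X * V) k i := by
    have h1 : (Z * X).trace = ((Zᴴ * V)ᴴ * (X * V)).trace := by
      rw [Matrix.conjTranspose_mul, Matrix.conjTranspose_conjTranspose, Matrix.mul_assoc,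
        Matrix.trace_mul_comm Vᴴ, Matrix.mul_assoc, Matrix.mul_assoc, hVV, Matrix.mul_one]
    rw [h1]; rfl
  rw [htr, traceNorm]
  refine (norm_sum_le _ _).trans (Finset.sum_le_sum fun i _ => ?_)
  calc ‖∑ k, star ((Zᴴ * V) k i) * (X * V) k i‖ ≤ ∑ k, ‖(Zᴴ * V) k i‖ * ‖(X * V) k i‖ := by
        refine (norm_sum_le _ _).trans (le_of_eq (Finset.sum_congr rfl fun k _ => ?_))
        rw [norm_mul, norm_star]
    _ ≤ √(∑ k, ‖(Zᴴ * V) k i‖ ^ 2) * √(∑ k, ‖(X * V) k i‖ ^ 2) :=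
        Real.sum_mul_le_sqrt_mul_sqrt _ _ _
    _ = √(hX.eigenvalues i) := by rw [hY, hW, Real.sqrt_one, one_mul]

theorem trace_sq_observable_le (O : Observable ι) :
    (O.1 * O.1).trace.re ≤ Fintype.card ι := by
  have hcol : ∀ x, ∑ y, ‖O.1 y x‖ ^ 2 ≤ 1 := by
    intro x
    have h1 := (Matrix.toEuclideanCLM (n := ι) (𝕜 := ℂ) O.1).le_opNorm (EuclideanSpace.single x 1)
    rw [PiLp.norm_single, norm_one, mul_one] at h1
    have h2 := h1.trans O.2.2
    have h3 : Matrix.toEuclideanCLM (n := ι) (𝕜 := ℂ) O.1 (EuclideanSpace.single x 1) =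
        WithLp.toLp 2 (O.1.col x) := by
      ext y
      simp [Matrix.ofLp_toEuclideanCLM]
    rw [h3, EuclideanSpace.norm_eq, Real.sqrt_le_iff, one_pow] at h2
    exact h2.2
  have htr : (O.1 * O.1).trace.re = ∑ x, ∑ y, ‖O.1 y x‖ ^ 2 := by
    simp only [Matrix.trace, Matrix.diag, Matrix.mul_apply, Complex.re_sum]
    refine Finset.sum_congr rfl fun x _ => Finset.sum_congr rfl fun y _ => ?_
    have : O.1 x y = star (O.1 y x) := (O.2.1.apply x y).symm
    rw [this, Complex.star_def, Complex.conj_mul', ← Complex.ofReal_pow, Complex.ofReal_re]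
  rw [htr]
  calc _ ≤ ∑ _x : ι, (1 : ℝ) := Finset.sum_le_sum fun x _ => hcol x
    _ = _ := by simp

theorem ampliation_single (E : Channel ι) (x : ι) :
    ampliation ι E.toLin (Matrix.single (x, x) (x, x) 1) =
      Matrix.kronecker (E.toLin (Matrix.single x x 1)) (Matrix.single x x 1) := by
  ext ⟨i, k⟩ ⟨j, l⟩
  simp only [ampliation, Matrix.of_apply, Matrix.kronecker, Matrix.kroneckerMap_apply]
  have : (Matrix.of fun i j => (Matrix.single (x, x) (x, x) (1 : ℂ)) (i, k) (j, l)) =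
      (Matrix.single x x (1 : ℂ) k l) • Matrix.single x x (1 : ℂ) := by
    ext a b
    simp only [Matrix.of_apply, Matrix.single_apply, Matrix.smul_apply, Prod.mk.injEq,
      smul_eq_mul]
    grind
  rw [this, map_smul, Matrix.smul_apply, smul_eq_mul, mul_comm]

/-- A process close to a unitary one nearly reproduces its output on a basis state. -/
theorem one_sub_le_fidelity (E : Channel ι) (U : Matrix.unitaryGroup ι ℂ) (x : ι) {ε : ℝ}
    (hε : 0 ≤ ε) (h : diamondDist E (unitaryChannel U) ≤ ENNReal.ofReal ε) :
    1 - ε ≤ (E.toLin (Matrix.single x x 1) *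
      ((U : Matrix ι ι ℂ) * Matrix.single x x 1 * (U : Matrix ι ι ℂ)ᴴ)).trace.re := by
  set σ := E.toLin (Matrix.single x x 1) with hσ
  set R : Matrix ι ι ℂ := Matrix.single x x 1 with hR
  set π : Matrix ι ι ℂ := (U : Matrix ι ι ℂ) * R * (U : Matrix ι ι ℂ)ᴴ with hπ
  have hU : (U : Matrix ι ι ℂ)ᴴ * (U : Matrix ι ι ℂ) = 1 := Matrix.mem_unitaryGroup_iff'.1 U.2
  have hRtr : R.trace = 1 := by simp [hR]
  have hRR : R * R = R := by simp [hR]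
  have hRH : Rᴴ = R := (posSemidef_single x).1
  have hπH : πᴴ = π := by
    simp only [hπ, Matrix.conjTranspose_mul, Matrix.conjTranspose_conjTranspose, hRH,
      Matrix.mul_assoc]
  have hππ : π * π = π := by
    calc π * π = (U : Matrix ι ι ℂ) * R * ((U : Matrix ι ι ℂ)ᴴ * (U : Matrix ι ι ℂ)) * R *
          (U : Matrix ι ι ℂ)ᴴ := by simp only [hπ, Matrix.mul_assoc]
      _ = π := by rw [hU, Matrix.mul_one, Matrix.mul_assoc _ R R, hRR]
  have hπtr : π.trace = 1 := by
    rw [hπ, Matrix.trace_mul_comm, ← Matrix.mul_assoc, hU, Matrix.one_mul, hRtr]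
  have hσtr : σ.trace = 1 := by rw [hσ, E.trace_map, hRtr]
  have hstate : (Matrix.single (x, x) (x, x) (1 : ℂ) : Matrix (ι × ι) (ι × ι) ℂ).PosSemidef ∧
      (Matrix.single (x, x) (x, x) (1 : ℂ) : Matrix (ι × ι) (ι × ι) ℂ).trace = 1 :=
    ⟨posSemidef_single _, by simp⟩
  have h1 := (le_iSup (fun ρ : State (ι × ι) => ENNReal.ofReal (traceNorm
    (ampliation ι E.toLin ρ.1 - ampliation ι (unitaryChannel U).toLin ρ.1) / 2))
    ⟨_, hstate⟩).trans h
  rw [ENNReal.ofReal_le_ofReal_iff hε] at h1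
  simp only [ampliation_single] at h1
  have hch : (unitaryChannel U).toLin R = π := rfl
  rw [hch] at h1
  have hsub : Matrix.kronecker σ R - Matrix.kronecker π R = Matrix.kronecker (σ - π) R := by
    ext a b
    simp [Matrix.kronecker, sub_mul]
  rw [hsub] at h1
  -- test the difference of the outputs with the reflection `1 - 2 π`
  set Z : Matrix ι ι ℂ := 1 - (2 : ℂ) • π with hZ
  have hZH : Zᴴ = Z := by
    rw [hZ, Matrix.conjTranspose_sub, Matrix.conjTranspose_one, Matrix.conjTranspose_smul, hπH]
    simp
  have hZZ : Z * Z = 1 := by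
    simp only [hZ, Matrix.sub_mul, Matrix.mul_sub, Matrix.one_mul, Matrix.mul_one,
      Matrix.smul_mul, Matrix.mul_smul, hππ]
    module
  have hun : Matrix.kronecker Z (1 : Matrix ι ι ℂ) *
      (Matrix.kronecker Z (1 : Matrix ι ι ℂ))ᴴ = 1 := by
    have e1 : (Matrix.kronecker Z (1 : Matrix ι ι ℂ))ᴴ = Matrix.kronecker Z (1 : Matrix ι ι ℂ) := by
      refine (Matrix.conjTranspose_kronecker _ _).trans ?_
      rw [hZH, Matrix.conjTranspose_one]; rfl
    rw [e1]
    refine (Matrix.mul_kronecker_mul _ _ _ _).symm.trans ?_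
    rw [hZZ, Matrix.one_mul, Matrix.one_kronecker_one]
  have h2 := norm_trace_mul_le_traceNorm hun (Matrix.kronecker (σ - π) R)
  have h3 : (Matrix.kronecker Z (1 : Matrix ι ι ℂ) * Matrix.kronecker (σ - π) R).trace =
      2 - 2 * (σ * π).trace := by
    have e1 : Matrix.kronecker Z (1 : Matrix ι ι ℂ) * Matrix.kronecker (σ - π) R =
        Matrix.kronecker (Z * (σ - π)) (1 * R) := (Matrix.mul_kronecker_mul _ _ _ _).symm
    rw [e1]
    refine (Matrix.trace_kronecker _ _).trans ?_
    rw [Matrix.one_mul, hRtr, mul_one, hZ, Matrix.sub_mul, Matrix.one_mul, Matrix.smul_mul,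
      Matrix.mul_sub, hππ, Matrix.trace_sub, Matrix.trace_smul, Matrix.trace_sub,
      Matrix.trace_sub, hπtr, hσtr, Matrix.trace_mul_comm, smul_eq_mul]
    ring
  rw [h3] at h2
  have h4 := (Complex.re_le_norm _).trans h2
  have h5 : (2 - 2 * (σ * π).trace : ℂ).re = 2 - 2 * (σ * π).trace.re := by simp
  rw [h5] at h4
  linarith

end Processes

theorem trace_sq_state_le {n : ℕ} {σ : Matrix (Qubits n) (Qubits n) ℂ} (h : σ.PosSemidef)
    (htr : σ.trace = 1) : (σ * σ).trace.re ≤ 1 := by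
  have h1 : (σ * σ).trace = ∑ q : Qubits n × Qubits n, σ q.1 q.2 * σ q.2 q.1 := by
    rw [Fintype.sum_prod_type]; rfl
  refine (Complex.re_le_norm _).trans ?_
  rw [h1]
  calc _ ≤ ∑ q : Qubits n × Qubits n, (σ q.1 q.1).re * (σ q.2 q.2).re := by
        refine (norm_sum_le _ _).trans (Finset.sum_le_sum fun q _ => ?_)
        rw [norm_mul]
        refine (norm_mul_norm_le_of_posSemidef h _ _ _ _).trans (le_of_eq ?_)
        ring
    _ = 1 := sum_diag_re_mul htr

/-- Chebyshev's inequality for the expectation value of an observable in the output state of a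
random brickwork circuit. -/
theorem RQC_deviation_le {n d : ℕ} (hn : 2 ≤ n) (hd : 2 ≤ d)
    {ρ O : Matrix (Qubits n) (Qubits n) ℂ} (h : ρ.PosSemidef) (htr : ρ.trace = 1)
    (hO : O.IsHermitian) (hO2 : (O * O).trace.re ≤ 2 ^ n) {τ : ℝ} (hτ : 0 < τ) :
    RQC n d {U | τ ≤ |(obsValue ρ O U).re - O.trace.re / 2 ^ n|} ≤
      ENNReal.ofReal ((4 / 3 / 2 ^ n + 5 * (4 / 5) ^ d) / τ ^ 2) := by
  have hc : Continuous fun U => ((obsValue ρ O U).re - O.trace.re / 2 ^ n) ^ 2 :=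
    ((Complex.continuous_re.comp (continuous_obsValue ρ O)).sub continuous_const).pow 2
  have hint : Integrable (fun U => ((obsValue ρ O U).re - O.trace.re / 2 ^ n) ^ 2) (RQC n d) := by
    rw [← integrableOn_univ]
    exact hc.continuousOn.integrableOn_compact isCompact_univ
  have h1 := mul_meas_ge_le_integral_of_nonneg
    (Filter.Eventually.of_forall fun U => sq_nonneg _) hint (τ ^ 2)
  have h2 := h1.trans (integral_sub_sq_le hn hd h htr hO hO2)
  have hset : {U | τ ≤ |(obsValue ρ O U).re - O.trace.re / 2 ^ n|} =
      {U | τ ^ 2 ≤ ((obsValue ρ O U).re - O.trace.re / 2 ^ n) ^ 2} := by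
    ext U
    simp only [Set.mem_ofPred_eq]
    rw [sq_le_sq, abs_of_pos hτ]
  rw [hset, ← ofReal_measureReal]
  refine ENNReal.ofReal_le_ofReal ?_
  rw [le_div_iff₀ (by positivity), mul_comm]
  exact h2

/-! ### Learning from uninformative answers -/

/-- The answer `Tr(O) / 2 ^ n`, which carries no information about the unknown process. -/
def blindAnswer {n : ℕ} (x : State (Qubits n) × Observable (Qubits n)) : ℝ :=
  x.2.1.trace.re / 2 ^ n

/-- The oracle that gives the uninformative answer whenever this is valid, and the exact
expectation value otherwise. -/
def lazyAnswer {n : ℕ} (E : Channel (Qubits n)) (τ : ℝ)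
    (x : State (Qubits n) × Observable (Qubits n)) : ℝ :=
  if |blindAnswer x - expectation E x.1 x.2| ≤ τ then blindAnswer x else expectation E x.1 x.2

theorem measurable_blindAnswer {n : ℕ} : Measurable (blindAnswer (n := n)) := by
  have h : Measurable fun M : Matrix (Qubits n) (Qubits n) ℂ => M.trace.re / 2 ^ n := by
    have : Continuous fun M : Matrix (Qubits n) (Qubits n) ℂ => M.trace.re / 2 ^ n := by fun_prop
    exact this.measurable
  exact h.comp (measurable_subtype_coe.comp measurable_snd)

/-- The expectation value is jointly measurable in the unitary, the state and the observable. -/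
theorem measurable_trace_conj {n : ℕ} {X : Type*} [MeasurableSpace X]
    {O ρ U : X → Matrix (Qubits n) (Qubits n) ℂ} (hO : Measurable O) (hρ : Measurable ρ)
    (hU : Measurable U) : Measurable fun x => (O x * (U x * ρ x * (U x)ᴴ)).trace.re := by
  have hent : ∀ {M : X → Matrix (Qubits n) (Qubits n) ℂ}, Measurable M →
      ∀ i j, Measurable fun x => M x i j := fun hM i j =>
    (measurable_pi_iff.1 ((measurable_pi_iff.1 hM) i)) j
  simp only [Matrix.trace, Matrix.diag, Matrix.mul_apply, Matrix.conjTranspose_apply]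
  refine Complex.measurable_re.comp (Finset.measurable_fun_sum _ fun i _ =>
    Finset.measurable_fun_sum _ fun j _ => (hent hO i j).mul
      (Finset.measurable_fun_sum _ fun k _ => (Finset.measurable_fun_sum _ fun l _ =>
        (hent hU j l).mul (hent hρ l k)).mul ?_))
  exact Complex.continuous_conj.measurable.comp (hent hU i k)

theorem isQPStat_lazyAnswer {n : ℕ} (U : Matrix.unitaryGroup (Qubits n) ℂ) {τ : ℝ} (hτ : 0 ≤ τ) :
    IsQPStat (unitaryChannel U) τ (lazyAnswer (unitaryChannel U) τ) := by
  have hexp : Measurable fun x : State (Qubits n) × Observable (Qubits n) =>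
      expectation (unitaryChannel U) x.1 x.2 :=
    measurable_trace_conj (measurable_subtype_coe.comp measurable_snd)
      (measurable_subtype_coe.comp measurable_fst) measurable_const
  refine ⟨?_, fun ρ O => ?_⟩
  · exact Measurable.ite
      (measurableSet_le (measurable_norm.comp (measurable_blindAnswer.sub hexp)) measurable_const)
      measurable_blindAnswer hexp
  · rw [lazyAnswer]
    split_ifs with h
    · exact h
    · simpa using hτ

section Learner

variable {n q : ℕ} {Ω : Type*} [MeasurableSpace Ω] (A : Learner (Qubits n) Ω q)

/-- The query number `k` if all earlier answers were uninformative. -/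
def Learner.blindQuery (k : Fin q) (ω : Ω) : State (Qubits n) × Observable (Qubits n) :=
  A.query k ω (A.answers blindAnswer ω k k.2.le)

theorem Learner.measurable_answers {f : State (Qubits n) × Observable (Qubits n) → ℝ}
    (hf : Measurable f) (k : ℕ) (hk : k ≤ q) : Measurable fun ω => A.answers f ω k hk := by
  induction k with
  | zero => exact measurable_pi_iff.2 fun i => i.elim0
  | succ k ih =>
    replace ih := ih (Nat.le_of_succ_le hk)
    refine measurable_pi_iff.2 fun i => ?_
    refine Fin.lastCases ?_ (fun i => ?_) i
    · simp only [Learner.answers, Fin.snoc_last]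
      exact hf.comp ((A.measurable_query ⟨k, hk⟩).comp (measurable_id.prodMk ih))
    · simp only [Learner.answers, Fin.snoc_castSucc]
      exact (measurable_pi_apply i).comp ih

theorem Learner.measurable_blindQuery (k : Fin q) : Measurable (A.blindQuery k) :=
  (A.measurable_query k).comp
    (measurable_id.prodMk (A.measurable_answers measurable_blindAnswer k k.2.le))

theorem Learner.answers_eq_of_forall {f g : State (Qubits n) × Observable (Qubits n) → ℝ} {ω : Ω}
    (h : ∀ k : Fin q, f (A.query k ω (A.answers g ω k k.2.le)) =
      g (A.query k ω (A.answers g ω k k.2.le))) (k : ℕ) (hk : k ≤ q) :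
    A.answers f ω k hk = A.answers g ω k hk := by
  induction k with
  | zero => rfl
  | succ k ih =>
    simp only [Learner.answers]
    rw [ih, h ⟨k, hk⟩]

/-- The first basis state. -/
def zeroState (n : ℕ) : Matrix (Qubits n) (Qubits n) ℂ := Matrix.single 0 0 1

/-- The output of the hypothesis, formed from uninformative answers, on the first basis state. -/
def Learner.blindOutput (ω : Ω) : Matrix (Qubits n) (Qubits n) ℂ :=
  (A.output blindAnswer ω).toLin (zeroState n)

theorem Learner.measurable_blindOutput : Measurable A.blindOutput :=
  (A.measurable_hypothesis (zeroState n)).comp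
    (measurable_id.prodMk (A.measurable_answers measurable_blindAnswer q le_rfl))

/-- The pairs of internal randomness and a unitary for which one of the uninformative answers is
(almost) invalid. -/
def Learner.revealing (τ : ℝ) (k : Fin q) : Set (Ω × Matrix.unitaryGroup (Qubits n) ℂ) :=
  {x | τ ≤ |(obsValue (A.blindQuery k x.1).1.1 (A.blindQuery k x.1).2.1 x.2).re -
    (A.blindQuery k x.1).2.1.trace.re / 2 ^ n|}

/-- The pairs of internal randomness and a unitary for which the hypothesis formed from
uninformative answers is accurate on the first basis state. -/
def Learner.lucky (ε : ℝ) : Set (Ω × Matrix.unitaryGroup (Qubits n) ℂ) :=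
  {x | 1 - ε ≤ (obsValue (zeroState n) (A.blindOutput x.1) x.2).re}

theorem Learner.measurableSet_revealing (τ : ℝ) (k : Fin q) :
    MeasurableSet (A.revealing τ k) := by
  have hq := (A.measurable_blindQuery k).comp
    (measurable_fst : Measurable (Prod.fst : Ω × Matrix.unitaryGroup (Qubits n) ℂ → Ω))
  have h1 := measurable_trace_conj (measurable_subtype_coe.comp (measurable_snd.comp hq))
    (measurable_subtype_coe.comp (measurable_fst.comp hq))
    (measurable_subtype_coe.comp (measurable_snd :
      Measurable (Prod.snd : Ω × Matrix.unitaryGroup (Qubits n) ℂ → _)))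
  exact measurableSet_le measurable_const
    (measurable_norm.comp (h1.sub (measurable_blindAnswer.comp hq)))

theorem Learner.measurableSet_lucky (ε : ℝ) : MeasurableSet (A.lucky ε) :=
  measurableSet_le measurable_const (measurable_trace_conj
    (A.measurable_blindOutput.comp measurable_fst) measurable_const
    (measurable_subtype_coe.comp measurable_snd))

/-- A learner that succeeds against all valid answers succeeds with uninformative ones, unless
these reveal something about the unitary. -/
theorem Learner.le_of_learns {P : Measure Ω} {τ ε α : ℝ} (hτ : 0 ≤ τ) (hε : 0 ≤ ε)
    {U : Matrix.unitaryGroup (Qubits n) ℂ} (h : A.Learns P τ ε α (unitaryChannel U)) :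
    ENNReal.ofReal α ≤
      P ((fun ω => (ω, U)) ⁻¹' ((⋃ k, A.revealing τ k) ∪ A.lucky ε)) := by
  refine (h _ (isQPStat_lazyAnswer U hτ)).trans (measure_mono fun ω hω => ?_)
  by_cases hrev : ∃ k, (ω, U) ∈ A.revealing τ k
  · exact Or.inl (Set.mem_iUnion.2 hrev)
  · right
    have hans : ∀ k : Fin q, lazyAnswer (unitaryChannel U) τ (A.blindQuery k ω) =
        blindAnswer (A.blindQuery k ω) := by
      intro k
      rw [lazyAnswer, if_pos]
      have hk : ¬ (τ ≤ _) := fun hk => hrev ⟨k, hk⟩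
      rw [not_le] at hk
      rw [abs_sub_comm]
      exact hk.le
    have hout : A.output (lazyAnswer (unitaryChannel U) τ) ω = A.output blindAnswer ω := by
      rw [Learner.output, Learner.output, A.answers_eq_of_forall hans]
    have hω : diamondDist (A.output (lazyAnswer (unitaryChannel U) τ) ω) (unitaryChannel U) ≤
      ENNReal.ofReal ε := hω
    rw [hout] at hω
    exact one_sub_le_fidelity _ U 0 hε hω

end Learner

/-- The query complexity bound in terms of the variance bound. -/
theorem mul_mul_sq_le_of_learns {n d q : ℕ} (hn : 2 ≤ n) (hd : 2 ≤ d) {Ω : Type*}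
    [MeasurableSpace Ω] (P : Measure Ω) [IsProbabilityMeasure P] (A : Learner (Qubits n) Ω q)
    {τ ε α β : ℝ} (hτ : 0 < τ) (hτε : τ ≤ ε) (hε : ε ≤ (1 - 1 / (2 : ℝ) ^ n) / 3)
    (hα : 0 ≤ α)
    (h : ENNReal.ofReal β ≤ RQC n d {U | A.Learns P τ ε α (unitaryChannel U)}) :
    α * β * τ ^ 2 ≤ (q + 1) * (4 / 3 / 2 ^ n + 5 * (4 / 5) ^ d) := by
  set B : ℝ := 4 / 3 / 2 ^ n + 5 * (4 / 5) ^ d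
  have hB : 0 ≤ B := by positivity
  set W : Set (Ω × Matrix.unitaryGroup (Qubits n) ℂ) := (⋃ k, A.revealing τ k) ∪ A.lucky ε
  have hW : MeasurableSet W :=
    (MeasurableSet.iUnion fun k => A.measurableSet_revealing τ k).union (A.measurableSet_lucky ε)
  have hρ : (zeroState n).PosSemidef := posSemidef_single _
  have hρtr : (zeroState n).trace = 1 := by simp [zeroState]
  have hfib : ∀ ω, RQC n d (Prod.mk ω ⁻¹' W) ≤ (q + 1 : ℕ) * ENNReal.ofReal (B / τ ^ 2) := by
    intro ω
    have h1 : ∀ k, RQC n d (Prod.mk ω ⁻¹' A.revealing τ k) ≤ ENNReal.ofReal (B / τ ^ 2) := by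
      intro k
      refine RQC_deviation_le hn hd (A.blindQuery k ω).1.2.1 (A.blindQuery k ω).1.2.2
        (A.blindQuery k ω).2.2.1 ?_ hτ
      simpa using trace_sq_observable_le (A.blindQuery k ω).2
    have h2 : RQC n d (Prod.mk ω ⁻¹' A.lucky ε) ≤ ENNReal.ofReal (B / τ ^ 2) := by
      -- the output of a fixed hypothesis is itself an observable, with mean value `1 / 2 ^ n`
      have hσ : (A.blindOutput ω).PosSemidef := (A.output blindAnswer ω).posSemidef_map hρ
      have hσtr : (A.blindOutput ω).trace = 1 :=
        ((A.output blindAnswer ω).trace_map _).trans hρtr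
      refine (measure_mono fun U hU => ?_).trans (RQC_deviation_le hn hd hρ hρtr hσ.1
        ((trace_sq_state_le hσ hσtr).trans (one_le_pow₀ (by norm_num))) hτ)
      have hU : 1 - ε ≤ (obsValue (zeroState n) (A.blindOutput ω) U).re := hU
      change τ ≤ |_ - (A.blindOutput ω).trace.re / 2 ^ n|
      rw [hσtr, Complex.one_re]
      exact le_trans (by linarith) (le_abs_self _)
    calc RQC n d (Prod.mk ω ⁻¹' W)
        ≤ (∑ k, RQC n d (Prod.mk ω ⁻¹' A.revealing τ k)) + RQC n d (Prod.mk ω ⁻¹' A.lucky ε) := by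
          rw [Set.preimage_union, Set.preimage_iUnion]
          refine (measure_union_le _ _).trans (add_le_add_left ?_ _)
          exact measure_iUnion_fintype_le _ _
      _ ≤ (∑ _k : Fin q, ENNReal.ofReal (B / τ ^ 2)) + ENNReal.ofReal (B / τ ^ 2) :=
          add_le_add (Finset.sum_le_sum fun k _ => h1 k) h2
      _ = _ := by simp [add_mul]
  have hmain : ENNReal.ofReal α * ENNReal.ofReal β ≤
      (q + 1 : ℕ) * ENNReal.ofReal (B / τ ^ 2) := by
    calc ENNReal.ofReal α * ENNReal.ofReal β
        ≤ ENNReal.ofReal α * RQC n d {U | ENNReal.ofReal α ≤ P ((fun ω => (ω, U)) ⁻¹' W)} := by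
          refine mul_le_mul_right (h.trans (measure_mono fun U hU => ?_)) _
          exact A.le_of_learns hτ.le (hτ.le.trans hτε) hU
      _ ≤ ∫⁻ U, P ((fun ω => (ω, U)) ⁻¹' W) ∂(RQC n d) :=
          mul_meas_ge_le_lintegral (measurable_measure_prodMk_right hW) _
      _ = (P.prod (RQC n d)) W := (Measure.prod_apply_symm hW).symm
      _ = ∫⁻ ω, RQC n d (Prod.mk ω ⁻¹' W) ∂P := Measure.prod_apply hW
      _ ≤ ∫⁻ _ω, (q + 1 : ℕ) * ENNReal.ofReal (B / τ ^ 2) ∂P := lintegral_mono hfib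
      _ = _ := by simp
  rw [← ENNReal.ofReal_mul hα, ← ENNReal.ofReal_natCast, ← ENNReal.ofReal_mul (by positivity),
    ENNReal.ofReal_le_ofReal_iff (by positivity), ← mul_div_assoc,
    le_div_iff₀ (by positivity)] at hmain
  push_cast at hmain
  exact hmain

/-! ### The range of depths -/

theorem le_pow_of_logb_div_le {n d : ℕ} (hn : 1 ≤ n)
    (h : Real.logb 2 n / Real.logb 2 (5 / 4) ≤ d) : (n : ℝ) ≤ (5 / 4) ^ d := by
  have h54 : 0 < Real.logb 2 (5 / 4) := Real.logb_pos (by norm_num) (by norm_num)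
  rw [div_le_iff₀ h54, ← Real.logb_pow, Real.logb_le_logb (by norm_num)
    (by exact_mod_cast hn) (by positivity)] at h
  exact h

theorem pow_le_of_le_logb_div {n d : ℕ} (hn : 1 ≤ n)
    (h : (d : ℝ) ≤ (n + Real.logb 2 n) / Real.logb 2 (5 / 4)) :
    (5 / 4 : ℝ) ^ d ≤ 2 ^ n * n := by
  have h54 : 0 < Real.logb 2 (5 / 4) := Real.logb_pos (by norm_num) (by norm_num)
  have hn0 : (0 : ℝ) < n := by exact_mod_cast hn
  have h2 : Real.logb 2 ((2 : ℝ) ^ n * n) = n + Real.logb 2 n := by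
    rw [Real.logb_mul (by positivity) hn0.ne', Real.logb_pow, Real.logb_self_eq_one (by norm_num),
      mul_one]
  rw [le_div_iff₀ h54, ← Real.logb_pow, ← h2, Real.logb_le_logb (by norm_num)
    (by positivity) (by positivity)] at h
  exact h

end PSQ

end

theorem mainTheorem1 :
    ∃ c : ℝ, 0 < c ∧
      ∀ (n d : ℕ) (τ ε α β : ℝ) (q : ℕ) (Ω : Type*) [MeasurableSpace Ω]
        (P : MeasureTheory.Measure Ω) [MeasureTheory.IsProbabilityMeasure P]
        (A : PSQ.Learner (PSQ.Qubits n) Ω q),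
        1 ≤ n →
        0 < τ → τ ≤ ε → ε ≤ (1 - 1 / (2 : ℝ) ^ n) / 3 →
        Real.logb 2 n / Real.logb 2 (5 / 4) ≤ d →
        d ≤ (n + Real.logb 2 n) / Real.logb 2 (5 / 4) →
        0 ≤ α → α ≤ 1 → 0 ≤ β → β ≤ 1 →
        ENNReal.ofReal β ≤
          PSQ.RQC n d {U | A.Learns P τ ε α (PSQ.unitaryChannel U)} →
        c * ((2 * α - 1) * β / n * τ ^ 2 * (5 / 4 : ℝ) ^ d) ≤ (q : ℝ) + 1 := by
  refine ⟨1 / 10, by norm_num, ?_⟩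
  intro n d τ ε α β q Ω _ P _ A hn hτ hτε hε hd1 hd2 hα hα1 hβ hβ1 h
  have hlow := PSQ.le_pow_of_logb_div_le hn hd1
  have hup := PSQ.pow_le_of_le_logb_div hn hd2
  have hn0 : (0 : ℝ) < n := by exact_mod_cast hn
  have hx : (0 : ℝ) < (5 / 4) ^ d := by positivity
  have hab : (2 * α - 1) * β ≤ α * β := mul_le_mul_of_nonneg_right (by linarith) hβ
  have hq : (0 : ℝ) ≤ q := Nat.cast_nonneg q
  have hred : (2 * α - 1) * β / n * τ ^ 2 * (5 / 4 : ℝ) ^ d ≤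
      α * β * τ ^ 2 * ((5 / 4 : ℝ) ^ d / n) := by
    calc (2 * α - 1) * β / n * τ ^ 2 * (5 / 4 : ℝ) ^ d
        = (2 * α - 1) * β * (τ ^ 2 * ((5 / 4 : ℝ) ^ d / n)) := by ring
      _ ≤ α * β * (τ ^ 2 * ((5 / 4 : ℝ) ^ d / n)) :=
          mul_le_mul_of_nonneg_right hab (by positivity)
      _ = _ := by ring
  have hτ1 : τ ≤ 1 := by
    have : 0 < 1 / (2 : ℝ) ^ n := by positivity
    linarith
  rcases Nat.lt_or_ge n 2 with hn2 | hn2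
  · -- on one qubit there are no gates, but the depth is bounded
    have hn1 : n = 1 := by omega
    subst hn1
    have hup : (5 / 4 : ℝ) ^ d ≤ 2 := by simpa using hup
    have h1 : α * β * τ ^ 2 ≤ 1 :=
      mul_le_one₀ (mul_le_one₀ hα1 hβ hβ1) (by positivity) (pow_le_one₀ hτ.le hτ1)
    have h2 : α * β * τ ^ 2 * ((5 / 4 : ℝ) ^ d / (1 : ℕ)) ≤ 1 * 2 := by
      refine mul_le_mul h1 ?_ (by positivity) (by norm_num)
      simpa using hup
    linarith
  · have hd : 2 ≤ d := by
      by_contra hd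
      have hd' : d = 0 ∨ d = 1 := by omega
      have : (2 : ℝ) ≤ n := by exact_mod_cast hn2
      rcases hd' with rfl | rfl <;> norm_num at hlow <;> linarith
    have hmain := PSQ.mul_mul_sq_le_of_learns hn2 hd P A hτ hτε hε hα h
    have hx1 : (4 / 5 : ℝ) ^ d * (5 / 4) ^ d = 1 := by rw [← mul_pow]; norm_num
    -- both terms of the variance bound are at most a constant times `n (4 / 5) ^ d`
    have hB : (4 / 3 / 2 ^ n + 5 * (4 / 5 : ℝ) ^ d) * ((5 / 4 : ℝ) ^ d / n) ≤ 19 / 3 := by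
      have e1 : (5 / 4 : ℝ) ^ d / n / 2 ^ n ≤ 1 := by
        rw [div_div, div_le_one (by positivity), mul_comm]
        exact hup
      have e2 : (1 : ℝ) / n ≤ 1 := by
        rw [div_le_one hn0]; exact_mod_cast hn
      calc _ = 4 / 3 * ((5 / 4 : ℝ) ^ d / n / 2 ^ n) +
            5 * ((4 / 5 : ℝ) ^ d * (5 / 4) ^ d) * (1 / n) := by ring
        _ ≤ _ := by rw [hx1]; linarith
    have h3 : α * β * τ ^ 2 * ((5 / 4 : ℝ) ^ d / n) ≤ (q + 1) * (19 / 3) := by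
      calc _ ≤ (q + 1) * (4 / 3 / 2 ^ n + 5 * (4 / 5 : ℝ) ^ d) * ((5 / 4 : ℝ) ^ d / n) :=
            mul_le_mul_of_nonneg_right hmain (by positivity)
        _ ≤ _ := by
            rw [mul_assoc]
            exact mul_le_mul_of_nonneg_left hB (by positivity)
    linarith
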